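/- Let $M$ be a closed (compact, Hausdorff, without boundary) smooth manifold of dimension $n$, and let $X$ be a smooth vector field on $M$ all of whose zeros are of Morse type; that is, around every zero $x$ of $X$ there are smooth coordinates $(x_1,\dots,x_n)$ centered at $x$ in which $$X=\sum_{i\le q}x_i\frac{\partial}{\partial x_i}-\sum_{i>q}x_i\frac{\partial}{\partial x_i}\qquad(*)$$ for some $0\le q\le n$. A Lyapunov form for $X$ is a smooth closed one form $\omega$ on $M$ with $\omega(X)<0$ at every point where $X\neq 0$, and a class $\xi\in H^1(M;\mathbb R)$ (de Rham cohomology) is called a Lyapunov cohomology class for $X$ if it is represented by a Lyapunov form for $X$. Every Lyapunov cohomology class $\xi$ for $X$ can be represented by a smooth closed one form $\omega$ for which there exists a smooth Riemannian metric $g$ on $M$ with $\omega=-g(X,\cdot)$. Moreover, given for every zero $x$ of $X$ coordinates $(x_1,\dots,x_n)$ centered at $x$ in which $X$ has the form $(*)$, one can choose $\omega$ and $g$, with $[\omega]=\xi$ and $\omega=-g(X,\cdot)$, such that for every zero $x$ one has, in a neighborhood of $x$ and with respect to the given coordinates, $$\omega=-\sum_{i\le q}x_i\,dx^i+\sum_{i>q}x_i\,dx^i\qquad\text{and}\qquad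 g=\sum_i(dx^i)^2.$$ -/

import Mathlib

open Set Filter Bundle
open scoped Manifold ContDiff Topology

noncomputable section

/-- The space of smooth (real valued) one forms on a smooth `n`-manifold `M`, i.e. the smooth
sections of the cotangent bundle. -/
abbrev OneForm (n : ℕ) (M : Type*) [TopologicalSpace M] [ChartedSpace (EuclideanSpace ℝ (Fin n)) M]
    [IsManifold (𝓡 n) ∞ M] : Type _ :=
  ContMDiffSection (𝓡 n) (EuclideanSpace ℝ (Fin n) →L[ℝ] ℝ) ∞
    (fun x : M => TangentSpace (𝓡 n) x →L[ℝ] ℝ)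

/-- The space of smooth vector fields on a smooth `n`-manifold `M`. -/
abbrev SmoothVectorField (n : ℕ) (M : Type*) [TopologicalSpace M]
    [ChartedSpace (EuclideanSpace ℝ (Fin n)) M] [IsManifold (𝓡 n) ∞ M] : Type _ :=
  ContMDiffSection (𝓡 n) (EuclideanSpace ℝ (Fin n)) ∞
    (fun x : M => TangentSpace (𝓡 n) x)

/-- Smooth Riemannian metrics on a smooth `n`-manifold `M`. -/
abbrev SmoothRiemannianMetric (n : ℕ) (M : Type*) [TopologicalSpace M]
    [ChartedSpace (EuclideanSpace ℝ (Fin n)) M] [IsManifold (𝓡 n) ∞ M] : Type _ :=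
  ContMDiffRiemannianMetric (𝓡 n) ∞ (EuclideanSpace ℝ (Fin n))
    (fun x : M => TangentSpace (𝓡 n) x)

namespace OneForm

variable {n : ℕ} {M : Type*} [TopologicalSpace M] [ChartedSpace (EuclideanSpace ℝ (Fin n)) M]
  [IsManifold (𝓡 n) ∞ M]

/-- The expression of a one form in a chart `e`: the pull back of `α` along `e.symm`
(only meaningful on `e.target`). -/
def inChart (α : OneForm n M) (e : OpenPartialHomeomorph M (EuclideanSpace ℝ (Fin n)))
    (y : EuclideanSpace ℝ (Fin n)) : EuclideanSpace ℝ (Fin n) →L[ℝ] ℝ :=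
  (α (e.symm y)).comp
    (mfderiv 𝓘(ℝ, EuclideanSpace ℝ (Fin n)) (𝓡 n) e.symm y)

/-- The expression of a one form in a chart, as an alternating form of degree one. -/
def altInChart (α : OneForm n M) (e : OpenPartialHomeomorph M (EuclideanSpace ℝ (Fin n)))
    (y : EuclideanSpace ℝ (Fin n)) : EuclideanSpace ℝ (Fin n) [⋀^Fin 1]→L[ℝ] ℝ :=
  ContinuousAlternatingMap.ofSubsingleton ℝ (EuclideanSpace ℝ (Fin n)) ℝ (0 : Fin 1) (α.inChart e y)

/-- A one form is closed if `dα = 0`; the exterior derivative is computed in charts. -/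
def Closed (α : OneForm n M) : Prop :=
  ∀ e ∈ IsManifold.maximalAtlas (𝓡 n) ∞ M, ∀ y ∈ e.target, extDeriv (α.altInChart e) y = 0

/-- `α = df`. -/
def IsDifferentialOf (α : OneForm n M) (f : C^∞⟮𝓡 n, M; ℝ⟯) : Prop :=
  ∀ (x : M) (v : TangentSpace (𝓡 n) x), α x v = mfderiv (𝓡 n) 𝓘(ℝ, ℝ) f x v

theorem contDiffOn_inChart (α : OneForm n M)
    {e : OpenPartialHomeomorph M (EuclideanSpace ℝ (Fin n))}
    (he : e ∈ IsManifold.maximalAtlas (𝓡 n) ∞ M) : ContDiffOn ℝ ∞ (α.inChart e) e.target := by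
  rw [contDiffOn_clm_apply]
  intro v
  rw [← contMDiffOn_iff_contDiffOn]
  have hsymm : ContMDiffOn 𝓘(ℝ, EuclideanSpace ℝ (Fin n)) (𝓡 n) ∞ e.symm e.target :=
    contMDiffOn_symm_of_mem_maximalAtlas he
  have ht := hsymm.contMDiffOn_tangentMapWithin (m := ∞) (by simp) e.open_target.uniqueMDiffOn
  have hs : ContMDiff 𝓘(ℝ, EuclideanSpace ℝ (Fin n)) 𝓘(ℝ, EuclideanSpace ℝ (Fin n)).tangent ∞
      (fun y : EuclideanSpace ℝ (Fin n) =>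
        (⟨y, v⟩ : TangentBundle 𝓘(ℝ, EuclideanSpace ℝ (Fin n)) (EuclideanSpace ℝ (Fin n)))) := by
    intro y
    rw [contMDiffAt_totalSpace]
    refine ⟨contMDiffAt_id, ?_⟩
    simp only [trivializationAt_model_space_apply]
    exact contMDiffAt_const
  have h1 := ht.comp hs.contMDiffOn (fun y hy => hy)
  have h2 : ContMDiffOn 𝓘(ℝ, EuclideanSpace ℝ (Fin n))
      ((𝓡 n).prod 𝓘(ℝ, EuclideanSpace ℝ (Fin n) →L[ℝ] ℝ)) ∞
      (fun y => TotalSpace.mk' (EuclideanSpace ℝ (Fin n) →L[ℝ] ℝ)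
        (E := fun x : M => TangentSpace (𝓡 n) x →L[ℝ] Bundle.Trivial M ℝ x)
        (e.symm y) (α (e.symm y))) e.target :=
    α.contMDiff.comp_contMDiffOn hsymm
  have h3 := ContMDiffOn.clm_bundle_apply (F₁ := EuclideanSpace ℝ (Fin n)) (F₂ := ℝ)
    (E₁ := fun x : M => TangentSpace (𝓡 n) x) (E₂ := Bundle.Trivial M ℝ) h2
    (v := fun y => mfderivWithin 𝓘(ℝ, EuclideanSpace ℝ (Fin n)) (𝓡 n) e.symm e.target y v) h1
  intro y hy
  have h4 := (contMDiffWithinAt_totalSpace.1 (h3 y hy)).2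
  refine h4.congr ?_ ?_
  · intro z hz
    simp [inChart, mfderivWithin_of_mem_nhds (e.open_target.mem_nhds hz)]
    rfl
  · simp [inChart, mfderivWithin_of_mem_nhds (e.open_target.mem_nhds hy)]
    rfl

theorem differentiableAt_altInChart (α : OneForm n M)
    {e : OpenPartialHomeomorph M (EuclideanSpace ℝ (Fin n))}
    (he : e ∈ IsManifold.maximalAtlas (𝓡 n) ∞ M) {y : EuclideanSpace ℝ (Fin n)}
    (hy : y ∈ e.target) : DifferentiableAt ℝ (α.altInChart e) y := by
  have h := ((α.contDiffOn_inChart he).differentiableOn (by simp)).differentiableAt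
    (e.open_target.mem_nhds hy)
  exact ((ContinuousAlternatingMap.ofSubsingletonLIE (𝕜 := ℝ) (E := EuclideanSpace ℝ (Fin n)) (F := ℝ)
    (ι := Fin 1) 0).toContinuousLinearEquiv.differentiableAt).comp y h

theorem altInChart_add (α η : OneForm n M)
    (e : OpenPartialHomeomorph M (EuclideanSpace ℝ (Fin n))) :
    (α + η).altInChart e = α.altInChart e + η.altInChart e := by
  ext y v
  simp [altInChart, inChart]
  rfl

theorem altInChart_smul (c : ℝ) (α : OneForm n M)
    (e : OpenPartialHomeomorph M (EuclideanSpace ℝ (Fin n))) :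
    (c • α).altInChart e = c • α.altInChart e := by
  ext y v
  simp [altInChart, inChart]
  rfl

variable (n M) in
/-- The space of closed one forms. -/
def closedForms : Submodule ℝ (OneForm n M) where
  carrier := {α | α.Closed}
  add_mem' := by
    intro α η hα hη e he y hy
    rw [altInChart_add, extDeriv_add (α.differentiableAt_altInChart he hy)
      (η.differentiableAt_altInChart he hy), hα e he y hy, hη e he y hy, add_zero]
  zero_mem' := by
    intro e he y hy
    have h0 : (0 : OneForm n M).altInChart e = (0 : ℝ) • (0 : OneForm n M).altInChart e := by
      ext y v
      simp [altInChart, inChart]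
      rfl
    rw [h0, extDeriv_smul, zero_smul]
  smul_mem' := by
    intro c α hα e he y hy
    rw [altInChart_smul, extDeriv_smul, hα e he y hy, smul_zero]

variable (n M) in
/-- The space of exact one forms, inside the closed one forms. -/
def exactForms : Submodule ℝ (closedForms n M) where
  carrier := {α | ∃ f : C^∞⟮𝓡 n, M; ℝ⟯, (α : OneForm n M).IsDifferentialOf f}
  add_mem' := by
    rintro α η ⟨f, hf⟩ ⟨g, hg⟩
    refine ⟨f + g, fun x v => ?_⟩
    have h := mfderiv_add (f.contMDiff.mdifferentiable (by simp) x)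
      (g.contMDiff.mdifferentiable (by simp) x)
    have h' := hf x v
    have h'' := hg x v
    rw [ContMDiffMap.coe_add, h]
    simp [h', h'']
    rfl
  zero_mem' := by
    refine ⟨ContMDiffMap.const 0, fun x v => ?_⟩
    have h : mfderiv (𝓡 n) 𝓘(ℝ, ℝ) (fun _ : M => (0 : ℝ)) x = 0 := mfderiv_const
    change (0 : ℝ) = mfderiv (𝓡 n) 𝓘(ℝ, ℝ) (fun _ : M => (0 : ℝ)) x v
    rw [h]; rfl
  smul_mem' := by
    rintro c α ⟨f, hf⟩
    refine ⟨c • f, fun x v => ?_⟩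
    have h := const_smul_mfderiv (f.contMDiff.mdifferentiable (by simp) x) c
    have h' := hf x v
    rw [ContMDiffMap.coe_smul, h]
    simp [h']
    rfl

end OneForm

/-- The first de Rham cohomology `H¹(M; ℝ)`: closed one forms modulo exact one forms. -/
abbrev DeRhamH1 (n : ℕ) (M : Type*) [TopologicalSpace M]
    [ChartedSpace (EuclideanSpace ℝ (Fin n)) M] [IsManifold (𝓡 n) ∞ M] : Type _ :=
  OneForm.closedForms n M ⧸ OneForm.exactForms n M

section Lyapunov

variable {n : ℕ} {M : Type*} [TopologicalSpace M] [ChartedSpace (EuclideanSpace ℝ (Fin n)) M]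
  [IsManifold (𝓡 n) ∞ M]

/-- The `i`-th coordinate differential `dxⁱ` of the chart `e` at the point `y`, evaluated at a
tangent vector `v`. -/
def coordDiff (e : OpenPartialHomeomorph M (EuclideanSpace ℝ (Fin n))) (i : Fin n) (y : M)
    (v : TangentSpace (𝓡 n) y) : ℝ :=
  EuclideanSpace.proj (𝕜 := ℝ) i (mfderiv (𝓡 n) 𝓘(ℝ, EuclideanSpace ℝ (Fin n)) e y v)

/-- `e` is a system of smooth coordinates `(x₁, …, xₙ)` centered at `x` in which
`X = ∑_{i ≤ q} xᵢ ∂/∂xᵢ - ∑_{i > q} xᵢ ∂/∂xᵢ`. (The coordinates are indexed by `0, …, n - 1`, so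
the first `q` of them are those with index `i < q`.) -/
structure IsMorseChart (X : SmoothVectorField n M) (x : M) (q : ℕ)
    (e : OpenPartialHomeomorph M (EuclideanSpace ℝ (Fin n))) : Prop where
  mem_maximalAtlas : e ∈ IsManifold.maximalAtlas (𝓡 n) ∞ M
  mem_source : x ∈ e.source
  map_eq_zero : e x = 0
  index_le : q ≤ n
  vectorField_eq : ∀ y ∈ e.source, ∀ i : Fin n,
    coordDiff e i y (X y) = if (i : ℕ) < q then e y i else -(e y i)

/-- The point `x` is a rest point of `X` of Morse type. -/
def IsMorseZero (X : SmoothVectorField n M) (x : M) : Prop :=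
  X x = 0 ∧ ∃ q e, IsMorseChart X x q e

/-- `α` is a Lyapunov form for `X`: it is closed, and `α(X) < 0` away from the zeros of `X`. -/
def IsLyapunovForm (X : SmoothVectorField n M) (α : OneForm n M) : Prop :=
  α.Closed ∧ ∀ x, X x ≠ 0 → α x (X x) < 0

/-- `ξ` is a Lyapunov cohomology class for `X`: it is represented by a Lyapunov form. -/
def IsLyapunovClass (X : SmoothVectorField n M) (ξ : DeRhamH1 n M) : Prop :=
  ∃ α : OneForm.closedForms n M, IsLyapunovForm X α ∧ (OneForm.exactForms n M).mkQ α = ξ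

/-- `α = -g(X, ·)`. -/
def IsNegDual (X : SmoothVectorField n M) (α : OneForm n M) (g : SmoothRiemannianMetric n M) :
    Prop :=
  ∀ (x : M) (v : TangentSpace (𝓡 n) x), α x v = -(g.inner x (X x) v)

/-- In a neighborhood of `x`, `α = -∑_{i ≤ q} xᵢ dxⁱ + ∑_{i > q} xᵢ dxⁱ` in the coordinates `e`. -/
def OneForm.IsStandardNear (α : OneForm n M) (x : M) (q : ℕ)
    (e : OpenPartialHomeomorph M (EuclideanSpace ℝ (Fin n))) : Prop :=
  ∀ᶠ y in 𝓝 x, ∀ v : TangentSpace (𝓡 n) y,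
    α y v = -(∑ i : Fin n, if (i : ℕ) < q then e y i * coordDiff e i y v else 0) +
      ∑ i : Fin n, if (i : ℕ) < q then 0 else e y i * coordDiff e i y v

/-- In a neighborhood of `x`, `g = ∑ᵢ (dxⁱ)²` in the coordinates `e`. -/
def IsEuclideanNear (g : SmoothRiemannianMetric n M) (x : M)
    (e : OpenPartialHomeomorph M (EuclideanSpace ℝ (Fin n))) : Prop :=
  ∀ᶠ y in 𝓝 x, ∀ v w : TangentSpace (𝓡 n) y,
    g.inner y v w = ∑ i : Fin n, coordDiff e i y v * coordDiff e i y w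

end Lyapunov

end

/-! Two modifications prove the theorem: an exact correction makes a Lyapunov form standard near the
zeros, and a partition of unity then produces the metric.

Near a zero, the Poincaré lemma gives α = dF with F(0) = 0, and X becomes a linear hyperbolic field
J. Let u and w be the squared norms of the expanding and contracting components, so Ju = 2u and Jw =
-2w. Interpolate between F and G = A(w) - A(u), where A is increasing and A(s) = s/2 near 0: the new
function is (1 - χ)F + χG. Along J its derivative is (1 - χ)JF + χJG + (Jχ)(G - F), and only the
last term can spoil negativity. The cutoff χ = β(u)β(w)γ(uw) controls it: uw is constant along J, so
γ is never differentiated, while its support confines Jχ ≠ 0 to regions close to the stable or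
unstable subspace and away from 0. There F is bounded below by a positive constant or above by a
negative one. If A is flat enough, |G| cannot overturn the sign of G - F, and the last term is
nonpositive (`exists_standardization_of_fderiv_hyperbolic_neg`). There are finitely many zeros, so
they can be treated in turn without changing the cohomology class.

For the metric, the required pointwise conditions are symmetry, positivity, α = -g(X, ·) and the
Euclidean form near zeros. They are convex in g, so local smooth solutions glue
(`IsLyapunovForm.exists_isNegDual`). Near a zero ∑(dxⁱ)² works; elsewhere α(X) < 0 splits the
tangent space as ℝX ⊕ ker α and `dualTensor` works. -/

noncomputable section

/-! ### The linear model: cutoffs, hyperbolic fields and standardization near the origin. -/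

section Euclidean

variable {n : ℕ}

local notation "𝔼" => EuclideanSpace ℝ (Fin n)

/-- A smooth nonincreasing cutoff equal to `1` on `(-∞, a]` and to `0` on `[b, ∞)`. -/
theorem exists_antitone_cutoff {a b : ℝ} (hab : a < b) :
    ∃ β : ℝ → ℝ, ContDiff ℝ ∞ β ∧ (∀ s ≤ a, β s = 1) ∧ (∀ s, b ≤ s → β s = 0) ∧
      (∀ s, 0 ≤ β s) ∧ (∀ s, β s ≤ 1) ∧ (∀ s, deriv β s ≤ 0) ∧
      (∀ s, deriv β s ≠ 0 → a ≤ s ∧ s ≤ b) := by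
  have hab' : 0 < b - a := sub_pos.2 hab
  let β : ℝ → ℝ := fun s => Real.smoothTransition ((b - s) / (b - a))
  have h1 : ∀ s ≤ a, β s = 1 := fun s hs =>
    Real.smoothTransition.one_of_one_le ((one_le_div hab').2 (by linarith))
  have h0 : ∀ s, b ≤ s → β s = 0 := fun s hs =>
    Real.smoothTransition.zero_of_nonpos (div_nonpos_of_nonpos_of_nonneg (by linarith) hab'.le)
  refine ⟨β, ?_, h1, h0, fun s => Real.smoothTransition.nonneg _,
    fun s => Real.smoothTransition.le_one _, fun s => ?_, fun s hs => ?_⟩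
  · exact Real.smoothTransition.contDiff.comp (by fun_prop)
  · have : Antitone β := fun s t hst =>
      Real.smoothTransition.monotone (by gcongr)
    exact this.deriv_nonpos
  · by_contra hcon
    rw [not_and_or, not_le, not_le] at hcon
    apply hs
    rcases hcon with h | h
    · have : β =ᶠ[𝓝 s] fun _ => 1 := by
        filter_upwards [Iio_mem_nhds h] with t ht using h1 t (le_of_lt ht)
      rw [this.deriv_eq, deriv_const]
    · have : β =ᶠ[𝓝 s] fun _ => 0 := by
        filter_upwards [Ioi_mem_nhds h] with t ht using h0 t (le_of_lt ht)
      rw [this.deriv_eq, deriv_const]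

/-- A strictly increasing smooth function which equals `s / 2` near `0` but is bounded above by a
prescribed small constant on a prescribed interval. -/
theorem exists_flat_profile {m b : ℝ} (hm : 0 < m) (hb : 0 < b) :
    ∃ A : ℝ → ℝ, ContDiff ℝ ∞ A ∧ (∀ᶠ s in 𝓝 0, A s = s / 2) ∧ (∀ s, 0 < deriv A s) ∧
      (∀ s ≤ b, A s ≤ m) ∧ ∀ s, 0 ≤ s → 0 ≤ A s := by
  -- The slope of `A` is 1/2 up to m/2 and κ/2 beyond m, never exceeding 1/2. So A(b) ≤ m/2 + κb/2 ≤
  -- m when b ≥ m, and A(b) ≤ b/2 otherwise.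
  set κ : ℝ := min (m / b) (1 / 2) with hκ
  have hκ0 : 0 < κ := lt_min (div_pos hm hb) (by norm_num)
  have hκm : κ * b ≤ m := by
    calc κ * b ≤ m / b * b := by gcongr; exact min_le_left _ _
      _ = m := by field_simp
  have hκ1 : κ ≤ 1 / 2 := min_le_right _ _
  obtain ⟨θ, hθ, hθ1, hθ0, hθn, hθl, -, -⟩ :=
    exists_antitone_cutoff (a := m / 2) (b := m) (by linarith)
  let a : ℝ → ℝ := fun s => (κ + (1 - κ) * θ s) / 2
  have ha : ContDiff ℝ ∞ a := by fun_prop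
  have hapos : ∀ s, 0 < a s := fun s => by
    have : 0 ≤ (1 - κ) * θ s := mul_nonneg (by linarith) (hθn s)
    simp only [a]; linarith
  have hale : ∀ s, a s ≤ 1 / 2 := fun s => by
    have : (1 - κ) * θ s ≤ (1 - κ) * 1 := mul_le_mul_of_nonneg_left (hθl s) (by linarith)
    simp only [a]; linarith
  let A : ℝ → ℝ := fun s => ∫ t in (0 : ℝ)..s, a t
  have hder : ∀ s, HasDerivAt A (a s) s := fun s =>
    intervalIntegral.integral_hasDerivAt_right (ha.continuous.intervalIntegrable _ _)
      (ha.continuous.stronglyMeasurableAtFilter _ _) ha.continuous.continuousAt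
  have hderiv : deriv A = a := funext fun s => (hder s).deriv
  have hmono : Monotone A := monotone_of_deriv_nonneg (fun s => (hder s).differentiableAt)
    fun s => by rw [hderiv]; exact (hapos s).le
  have hA0 : A 0 = 0 := by simp [A]
  have hAs : ∀ s ≤ m / 2, A s = s / 2 := by
    intro s hs
    have : A s = ∫ t in (0 : ℝ)..s, (1 / 2 : ℝ) := by
      apply intervalIntegral.integral_congr
      intro t ht
      have ht' : t ≤ m / 2 := by
        rcases le_total 0 s with h | h
        · rw [uIcc_of_le h] at ht; exact ht.2.trans hs
        · rw [uIcc_of_ge h] at ht; exact ht.2.trans (by linarith)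
      simp only [a, hθ1 t ht']; ring
    rw [this]; simp; ring
  refine ⟨A, ?_, ?_, fun s => by rw [hderiv]; exact hapos s, fun s hs => ?_, fun s hs => ?_⟩
  · rw [contDiff_infty_iff_deriv]
    exact ⟨fun s => (hder s).differentiableAt, by rwa [hderiv]⟩
  · filter_upwards [Iio_mem_nhds (show (0 : ℝ) < m / 2 by linarith)] with s hs
    exact hAs s (le_of_lt hs)
  · have hsplit : A b ≤ m := by
      rcases le_total b m with h | h
      · calc A b ≤ ∫ t in (0 : ℝ)..b, (1 / 2 : ℝ) :=
            intervalIntegral.integral_mono_on hb.le (ha.continuous.intervalIntegrable _ _)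
              (by simp) fun t _ => hale t
          _ ≤ m := by simp; linarith
      · have e : A b = (∫ t in (0 : ℝ)..m, a t) + ∫ t in m..b, a t :=
          (intervalIntegral.integral_add_adjacent_intervals
            (ha.continuous.intervalIntegrable _ _) (ha.continuous.intervalIntegrable _ _)).symm
        have e1 : (∫ t in (0 : ℝ)..m, a t) ≤ ∫ t in (0 : ℝ)..m, (1 / 2 : ℝ) :=
          intervalIntegral.integral_mono_on hm.le (ha.continuous.intervalIntegrable _ _)
              (by simp) fun t _ => hale t
        have e2 : (∫ t in m..b, a t) ≤ ∫ t in m..b, κ / 2 :=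
          intervalIntegral.integral_mono_on h (ha.continuous.intervalIntegrable _ _)
              (by simp) fun t ht => by simp [a, hθ0 t ht.1]
        simp only [intervalIntegral.integral_const, smul_eq_mul] at e1 e2
        nlinarith
    exact (hmono hs).trans hsplit
  · rw [← hA0]; exact hmono hs

/-- The linear hyperbolic vector field with expanding directions `p` and contracting directions
`¬ p`. -/
def hyperbolic (p : Fin n → Prop) [DecidablePred p] (x : EuclideanSpace ℝ (Fin n)) :
    EuclideanSpace ℝ (Fin n) :=
  WithLp.toLp 2 fun i => if p i then x i else -(x i)

/-- The sum of the squares of the coordinates with index in `p`. -/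
def partialSq (p : Fin n → Prop) [DecidablePred p] (x : EuclideanSpace ℝ (Fin n)) : ℝ :=
  ∑ i, if p i then x i ^ 2 else 0

section

variable (p : Fin n → Prop) [DecidablePred p]

theorem hyperbolic_apply (x : 𝔼) (i : Fin n) :
    hyperbolic p x i = if p i then x i else -(x i) := rfl

/-- Exchanging stable and unstable directions reverses time, so estimates near one subspace transfer
to the other by replacing F with -F. -/
theorem hyperbolic_not (x : 𝔼) : hyperbolic (fun i => ¬ p i) x = -hyperbolic p x := by
  ext i
  by_cases h : p i <;> simp [hyperbolic_apply, h]

theorem partialSq_nonneg (x : 𝔼) : 0 ≤ partialSq p x :=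
  Finset.sum_nonneg fun i _ => by split_ifs <;> positivity

theorem partialSq_zero : partialSq p (0 : 𝔼) = 0 := by simp [partialSq]

theorem partialSq_add_partialSq_not (x : 𝔼) :
    partialSq p x + partialSq (fun i => ¬ p i) x = ‖x‖ ^ 2 := by
  rw [EuclideanSpace.norm_sq_eq, partialSq, partialSq, ← Finset.sum_add_distrib]
  refine Finset.sum_congr rfl fun i _ => ?_
  by_cases h : p i <;> simp [h]

theorem contDiff_partialSq : ContDiff ℝ ∞ (partialSq p : 𝔼 → ℝ) := by
  unfold partialSq
  refine ContDiff.sum fun i _ => ?_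
  split_ifs <;> fun_prop

theorem fderiv_partialSq (x v : 𝔼) :
    fderiv ℝ (partialSq p) x v = 2 * ∑ i, if p i then x i * v i else 0 := by
  have : HasFDerivAt (partialSq p : 𝔼 → ℝ)
      (∑ i, if p i then (2 * x i) • (EuclideanSpace.proj i : 𝔼 →L[ℝ] ℝ) else 0) x := by
    unfold partialSq
    refine HasFDerivAt.fun_sum fun i _ => ?_
    split_ifs
    · simpa using ((EuclideanSpace.proj i : 𝔼 →L[ℝ] ℝ).hasFDerivAt (x := x)).pow 2
    · exact hasFDerivAt_const _ _
  rw [this.fderiv, sum_apply, Finset.mul_sum]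
  refine Finset.sum_congr rfl fun i _ => ?_
  split_ifs
  · simp; ring
  · simp

theorem fderiv_partialSq_hyperbolic (x : 𝔼) :
    fderiv ℝ (partialSq p) x (hyperbolic p x) = 2 * partialSq p x := by
  rw [fderiv_partialSq, partialSq]
  congr 1
  refine Finset.sum_congr rfl fun i _ => ?_
  split_ifs with h
  · simp [hyperbolic_apply, h]; ring
  · rfl

theorem fderiv_partialSq_not_hyperbolic (x : 𝔼) :
    fderiv ℝ (partialSq fun i => ¬ p i) x (hyperbolic p x) =
      -(2 * partialSq (fun i => ¬ p i) x) := by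
  rw [← fderiv_partialSq_hyperbolic, hyperbolic_not, map_neg, neg_neg]

theorem hyperbolic_eq_neg_of_partialSq_eq_zero {x : 𝔼} (hx : partialSq p x = 0) :
    hyperbolic p x = -x := by
  ext i
  rw [partialSq, Finset.sum_eq_zero_iff_of_nonneg
    (fun i _ => by split_ifs <;> positivity)] at hx
  have := hx i (Finset.mem_univ _)
  by_cases h : p i
  · simp [h] at this
    simp [hyperbolic_apply, this]
  · simp [hyperbolic_apply, h]

theorem partialSq_smul (t : ℝ) (x : 𝔼) : partialSq p (t • x) = t ^ 2 * partialSq p x := by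
  rw [partialSq, partialSq, Finset.mul_sum]
  refine Finset.sum_congr rfl fun i _ => ?_
  split_ifs <;> simp; ring

end

section

variable (p : Fin n → Prop) [DecidablePred p]

theorem partialSq_not_not (x : 𝔼) :
    partialSq (fun i => ¬ ¬ p i) x = partialSq p x := by
  simp [partialSq]

variable {p}

theorem mem_ball_of_partialSq_le {r a b : ℝ} (hr : 0 < r) (hab : a + b < r ^ 2) {x : 𝔼}
    (hu : partialSq p x ≤ a) (hw : partialSq (fun i => ¬ p i) x ≤ b) :
    x ∈ Metric.ball (0 : 𝔼) r := by
  rw [mem_ball_zero_iff]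
  have := partialSq_add_partialSq_not p x
  exact lt_of_pow_lt_pow_left₀ 2 hr.le (by linarith)

/-- A function decreasing along a hyperbolic linear vector field is positive on its stable
subspace. -/
theorem pos_of_fderiv_hyperbolic_neg {F : 𝔼 → ℝ} {r : ℝ}
    (hF : ∀ x ∈ Metric.ball (0 : 𝔼) r, DifferentiableAt ℝ F x) (hF0 : F 0 = 0)
    (hdec : ∀ x ∈ Metric.ball (0 : 𝔼) r, x ≠ 0 → fderiv ℝ F x (hyperbolic p x) < 0)
    {x : 𝔼} (hx : x ∈ Metric.ball (0 : 𝔼) r) (hx0 : x ≠ 0) (hp : partialSq p x = 0) : 0 < F x := by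
  have hmem : ∀ t ∈ Icc (0 : ℝ) 1, t • x ∈ Metric.ball (0 : 𝔼) r := by
    intro t ht
    rw [mem_ball_zero_iff] at hx ⊢
    rw [norm_smul, Real.norm_of_nonneg ht.1]
    exact (mul_le_of_le_one_left (norm_nonneg _) ht.2).trans_lt hx
  have hder : ∀ t ∈ Icc (0 : ℝ) 1,
      HasDerivAt (fun s : ℝ => F (s • x)) (fderiv ℝ F (t • x) x) t := by
    intro t ht
    have h1 : HasDerivAt (fun s : ℝ => s • x) x t := by
      simpa using (hasDerivAt_id t).smul_const x
    exact (hF _ (hmem t ht)).hasFDerivAt.comp_hasDerivAt t h1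
  -- On the stable subspace the field is -x, so decrease along it means increase along the ray
  -- leaving the origin, where F = 0.
  have hmono : StrictMonoOn (fun s : ℝ => F (s • x)) (Icc 0 1) := by
    refine strictMonoOn_of_deriv_pos (convex_Icc 0 1)
      (fun t ht => (hder t ht).continuousAt.continuousWithinAt) fun t ht => ?_
    rw [interior_Icc] at ht
    rw [(hder t (Ioo_subset_Icc_self ht)).deriv]
    have h := hdec _ (hmem t (Ioo_subset_Icc_self ht)) (smul_ne_zero ht.1.ne' hx0)
    rw [hyperbolic_eq_neg_of_partialSq_eq_zero p (by rw [partialSq_smul, hp, mul_zero]), map_neg,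
      map_smul, smul_eq_mul] at h
    have ht0 := ht.1
    by_contra hcon
    rw [not_lt] at hcon
    nlinarith
  have := hmono (left_mem_Icc.2 zero_le_one) (right_mem_Icc.2 zero_le_one) zero_lt_one
  simpa [hF0] using this

theorem isCompact_setOf_partialSq_le (a b : ℝ) :
    IsCompact {x : 𝔼 | partialSq p x ≤ a ∧ partialSq (fun i => ¬ p i) x ≤ b} := by
  refine Metric.isCompact_of_isClosed_isBounded ?_ ?_
  · exact (isClosed_le (contDiff_partialSq p).continuous continuous_const).inter
      (isClosed_le (contDiff_partialSq _).continuous continuous_const)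
  · refine Metric.isBounded_ball (x := (0 : 𝔼)) (r := Real.sqrt (|a + b| + 1)) |>.subset ?_
    rintro x ⟨h1, h2⟩
    refine mem_ball_of_partialSq_le (Real.sqrt_pos.2 (by positivity)) ?_ h1 h2
    rw [Real.sq_sqrt (by positivity)]
    linarith [le_abs_self (a + b)]

/-- Near the stable subspace and away from the origin, a function decreasing along a hyperbolic
linear vector field is bounded below by a positive constant. -/
theorem exists_pos_le_of_fderiv_hyperbolic_neg {F : 𝔼 → ℝ} {r a b : ℝ} (hr : 0 < r) (ha : 0 < a)
    (hb : b + b < r ^ 2) (hF : ∀ x ∈ Metric.ball (0 : 𝔼) r, DifferentiableAt ℝ F x) (hF0 : F 0 = 0)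
    (hdec : ∀ x ∈ Metric.ball (0 : 𝔼) r, x ≠ 0 → fderiv ℝ F x (hyperbolic p x) < 0) :
    ∃ m > 0, ∃ η > 0, ∀ x : 𝔼, a ≤ partialSq (fun i => ¬ p i) x →
      partialSq (fun i => ¬ p i) x ≤ b → partialSq p x ≤ b → partialSq p x ≤ η → m ≤ F x := by
  have hcu : Continuous (partialSq p : 𝔼 → ℝ) := (contDiff_partialSq p).continuous
  have hcw : Continuous (partialSq (fun i => ¬ p i) : 𝔼 → ℝ) := (contDiff_partialSq _).continuous
  set C : Set 𝔼 := {x | partialSq p x ≤ b ∧ partialSq (fun i => ¬ p i) x ≤ b} ∩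
    {x | a ≤ partialSq (fun i => ¬ p i) x} with hC
  have hCc : IsCompact C := (isCompact_setOf_partialSq_le b b).inter_right
    (isClosed_le continuous_const hcw)
  have hCb : C ⊆ Metric.ball (0 : 𝔼) r := fun x hx => mem_ball_of_partialSq_le hr hb hx.1.1 hx.1.2
  have hFc : ContinuousOn F C := fun x hx => (hF x (hCb hx)).continuousAt.continuousWithinAt
  have hK : IsCompact (C ∩ {x | partialSq p x = 0}) :=
    hCc.inter_right (isClosed_eq hcu continuous_const)
  obtain ⟨m, hm, hmK⟩ := hK.exists_forall_le' (hFc.mono inter_subset_left) (a := 0) fun x hx => by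
    refine pos_of_fderiv_hyperbolic_neg hF hF0 hdec (hCb hx.1) ?_ hx.2
    rintro rfl
    have := hx.1.2
    simp only [mem_ofPred_eq, partialSq_zero] at this
    linarith
  -- F ≥ m on the part of C with u = 0, so u has no zero on this compact set and is bounded below
  -- there by some η. Points of C with u ≤ η/2 thus satisfy F > m/2.
  have hL : IsCompact (C ∩ F ⁻¹' Iic (m / 2)) :=
    hCc.of_isClosed_subset (hFc.preimage_isClosed_of_isClosed hCc.isClosed isClosed_Iic)
      inter_subset_left
  obtain ⟨η, hη, hηL⟩ := hL.exists_forall_le' hcu.continuousOn (a := 0) fun x hx => by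
    refine (partialSq_nonneg p x).lt_of_ne fun h => ?_
    have h1 := hmK x ⟨hx.1, h.symm⟩
    have h2 : F x ≤ m / 2 := hx.2
    linarith
  refine ⟨m / 2, half_pos hm, η / 2, half_pos hη, fun x h1 h2 h3 h4 => ?_⟩
  by_contra hcon
  have := hηL x ⟨⟨⟨h3, h2⟩, h1⟩, (not_le.1 hcon).le⟩
  linarith

/-- A function decreasing along a hyperbolic linear vector field can be changed near the origin to
the standard quadratic form, keeping it decreasing. -/
theorem exists_standardization_of_fderiv_hyperbolic_neg {F : 𝔼 → ℝ} {r : ℝ} (hr : 0 < r)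
    (hF : ContDiffOn ℝ ∞ F (Metric.ball 0 r)) (hF0 : F 0 = 0)
    (hdec : ∀ x ∈ Metric.ball (0 : 𝔼) r, x ≠ 0 → fderiv ℝ F x (hyperbolic p x) < 0) :
    ∃ h : 𝔼 → ℝ, ContDiff ℝ ∞ h ∧ tsupport h ⊆ Metric.ball 0 r ∧
      (∀ᶠ x in 𝓝 0, F x + h x = (partialSq (fun i => ¬ p i) x - partialSq p x) / 2) ∧
      ∀ x ∈ Metric.ball (0 : 𝔼) r, x ≠ 0 →
        fderiv ℝ F x (hyperbolic p x) + fderiv ℝ h x (hyperbolic p x) < 0 := by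
  have hFd : ∀ x ∈ Metric.ball (0 : 𝔼) r, DifferentiableAt ℝ F x := fun x hx =>
    (hF.contDiffAt (Metric.isOpen_ball.mem_nhds hx)).differentiableAt (by simp)
  have hr2 : 0 < r ^ 2 := by positivity
  -- Any 0 < a < b with 2b < r² would do: the last condition puts {u ≤ b, w ≤ b} inside the ball.
  obtain ⟨b, hb⟩ : ∃ b, b = r ^ 2 / 4 := ⟨_, rfl⟩
  obtain ⟨a, ha⟩ : ∃ a, a = r ^ 2 / 8 := ⟨_, rfl⟩
  have ha0 : 0 < a := by linarith
  have hb0 : 0 < b := by linarith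
  have hbb : b + b < r ^ 2 := by linarith
  obtain ⟨m₁, hm₁, η₁, hη₁, hlow⟩ :=
    exists_pos_le_of_fderiv_hyperbolic_neg hr ha0 hbb hFd hF0 hdec
  obtain ⟨m₂, hm₂, η₂, hη₂, hup⟩ :=
    exists_pos_le_of_fderiv_hyperbolic_neg (p := fun i => ¬ p i) (F := fun x => -F x) hr ha0 hbb
      (fun x hx => (hFd x hx).neg) (by simp [hF0]) (fun x hx hx0 => by
        rw [hyperbolic_not, fderiv_fun_neg]
        simpa using hdec x hx hx0)
  simp only [partialSq_not_not] at hup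
  obtain ⟨A, hA, hA0, hApos, hAle, hAnn⟩ := exists_flat_profile (lt_min hm₁ hm₂) hb0
  obtain ⟨β, hβ, hβ1, hβ0, hβn, hβl, hβd, hβs⟩ :=
    exists_antitone_cutoff (a := a) (b := b) (by linarith)
  -- If uw < ε and one factor is at least a, the other is below both η₁ and η₂, so the bounds on F
  -- apply.
  obtain ⟨ε, hε⟩ : ∃ ε, ε = a * min η₁ η₂ := ⟨_, rfl⟩
  have hε0 : 0 < ε := hε ▸ mul_pos ha0 (lt_min hη₁ hη₂)
  obtain ⟨γ, hγ, hγ1, hγ0, hγn, hγl, -, -⟩ :=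
    exists_antitone_cutoff (a := ε / 2) (b := ε) (by linarith)
  have hus := contDiff_partialSq p
  have hws := contDiff_partialSq fun i => ¬ p i
  have hun := partialSq_nonneg p
  have hwn := partialSq_nonneg fun i => ¬ p i
  have huJ := fderiv_partialSq_hyperbolic p
  have hwJ := fderiv_partialSq_not_hyperbolic p
  have hnorm := partialSq_add_partialSq_not p
  have hball : ∀ x : 𝔼, partialSq p x ≤ b → partialSq (fun i => ¬ p i) x ≤ b →
    x ∈ Metric.ball (0 : 𝔼) r := fun x h1 h2 => mem_ball_of_partialSq_le hr hbb h1 h2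
  have hu0 := partialSq_zero p
  have hw0 := partialSq_zero fun i => ¬ p i
  generalize partialSq p = u at *
  generalize partialSq (fun i => ¬ p i) = w at *
  let χ : 𝔼 → ℝ := fun x => β (u x) * β (w x) * γ (u x * w x)
  have hχ : ContDiff ℝ ∞ χ :=
    ((hβ.comp hus).mul (hβ.comp hws)).mul (hγ.comp (hus.mul hws))
  let h : 𝔼 → ℝ := fun x => χ x * (A (w x) - A (u x) - F x)
  have hts : tsupport h ⊆ {x | u x ≤ b ∧ w x ≤ b} := by
    refine closure_minimal (fun x hx => ?_) ((isClosed_le hus.continuous continuous_const).inter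
      (isClosed_le hws.continuous continuous_const))
    by_contra hcon
    rw [mem_ofPred_eq, not_and_or, not_le, not_le] at hcon
    apply hx
    rcases hcon with hc | hc <;> simp [h, χ, hβ0 _ hc.le]
  have htb : tsupport h ⊆ Metric.ball 0 r := fun x hx => hball x (hts hx).1 (hts hx).2
  refine ⟨h, ?_, htb, ?_, fun x hx hx0 => ?_⟩
  · rw [contDiff_iff_contDiffAt]
    intro x
    by_cases hx : x ∈ Metric.ball (0 : 𝔼) r
    · exact hχ.contDiffAt.mul (((hA.comp hws).sub (hA.comp hus)).contDiffAt.sub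
        (hF.contDiffAt (Metric.isOpen_ball.mem_nhds hx)))
    · exact contDiffAt_const.congr_of_eventuallyEq
        (notMem_tsupport_iff_eventuallyEq.1 fun hx' => hx (htb hx'))
  · have hut : Tendsto u (𝓝 0) (𝓝 0) := by simpa [hu0] using hus.continuous.tendsto 0
    have hwt : Tendsto w (𝓝 0) (𝓝 0) := by simpa [hw0] using hws.continuous.tendsto 0
    have huwt : Tendsto (fun x => u x * w x) (𝓝 0) (𝓝 0) := by simpa using hut.mul hwt
    filter_upwards [hut.eventually hA0, hwt.eventually hA0, hut.eventually (Iio_mem_nhds ha0),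
      hwt.eventually (Iio_mem_nhds ha0), huwt.eventually (Iio_mem_nhds (half_pos hε0))]
      with x h1 h2 h3 h4 h5
    simp only [h, χ, hβ1 _ (le_of_lt h3), hβ1 _ (le_of_lt h4), hγ1 _ (le_of_lt h5), h1, h2]
    ring
  · have du : HasFDerivAt u (fderiv ℝ u x) x := (hus.differentiable (by simp) x).hasFDerivAt
    have dw : HasFDerivAt w (fderiv ℝ w x) x := (hws.differentiable (by simp) x).hasFDerivAt
    have dβ : ∀ s, HasDerivAt β (deriv β s) s := fun s =>
      (hβ.differentiable (by simp) s).hasDerivAt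
    have dγ : ∀ s, HasDerivAt γ (deriv γ s) s := fun s =>
      (hγ.differentiable (by simp) s).hasDerivAt
    have dA : ∀ s, HasDerivAt A (deriv A s) s := fun s =>
      (hA.differentiable (by simp) s).hasDerivAt
    have dh := ((((dβ (u x)).comp_hasFDerivAt x du).mul ((dβ (w x)).comp_hasFDerivAt x dw)).mul
      ((dγ (u x * w x)).comp_hasFDerivAt x (du.mul dw))).mul
      ((((dA (w x)).comp_hasFDerivAt x dw).sub ((dA (u x)).comp_hasFDerivAt x du)).sub
        (hFd x hx).hasFDerivAt)
    have dh' : fderiv ℝ h x = _ := dh.fderiv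
    rw [dh']
    have hF' := hdec x hx hx0
    have hpos : 0 < u x + w x := by rw [hnorm]; positivity
    simp only [Function.comp_apply, add_apply, sub_apply, smul_apply, smul_eq_mul, Pi.mul_apply,
      huJ, hwJ, Pi.sub_apply]
    generalize fderiv ℝ F x (hyperbolic p x) = f' at *
    have hu := hun x
    have hw := hwn x
    -- Where this is nonzero, a ≤ u ≤ b and w ≤ η₂, so F ≤ -m₂, while A(u) ≤ m₂ and A(w) ≥ 0. Hence
    -- G - F ≥ 0, against β' ≤ 0. The term `t2` is the mirror image near the stable subspace.
    have t1 : (deriv β (u x) * (2 * u x) * β (w x) * γ (u x * w x)) *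
        (A (w x) - A (u x) - F x) ≤ 0 := by
      by_cases hz : deriv β (u x) = 0 ∨ b ≤ w x ∨ ε ≤ u x * w x
      · rcases hz with hz | hz | hz
        · simp [hz]
        · simp [hβ0 _ hz]
        · simp [hγ0 _ hz]
      · push Not at hz
        obtain ⟨z1, z2, z3⟩ := hz
        obtain ⟨z4, z5⟩ := hβs _ z1
        have z6 : w x ≤ η₂ := by
          have : a * w x ≤ a * min η₁ η₂ := by
            rw [← hε]; exact (mul_le_mul_of_nonneg_right z4 hw).trans z3.le
          exact (le_of_mul_le_mul_left this ha0).trans (min_le_right _ _)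
        have z7 := hup x z4 z5 z2.le z6
        have z8 := (hAle (u x) z5).trans (min_le_right m₁ m₂)
        have z9 := hAnn (w x) hw
        refine mul_nonpos_of_nonpos_of_nonneg ?_ (by linarith)
        have := hβd (u x)
        have e1 : 0 ≤ 2 * u x * β (w x) * γ (u x * w x) := by
          have := hβn (w x); have := hγn (u x * w x); positivity
        calc _ = deriv β (u x) * (2 * u x * β (w x) * γ (u x * w x)) := by ring
          _ ≤ 0 := mul_nonpos_of_nonpos_of_nonneg this e1
    have t2 : (β (u x) * (deriv β (w x) * (-(2 * w x))) * γ (u x * w x)) *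
        (A (w x) - A (u x) - F x) ≤ 0 := by
      by_cases hz : deriv β (w x) = 0 ∨ b ≤ u x ∨ ε ≤ u x * w x
      · rcases hz with hz | hz | hz
        · simp [hz]
        · simp [hβ0 _ hz]
        · simp [hγ0 _ hz]
      · push Not at hz
        obtain ⟨z1, z2, z3⟩ := hz
        obtain ⟨z4, z5⟩ := hβs _ z1
        have z6 : u x ≤ η₁ := by
          have : a * u x ≤ a * min η₁ η₂ := by
            rw [← hε, mul_comm a]
            exact (mul_le_mul_of_nonneg_left z4 hu).trans z3.le
          exact (le_of_mul_le_mul_left this ha0).trans (min_le_left _ _)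
        have z7 := hlow x z4 z5 z2.le z6
        have z8 := (hAle (w x) z5).trans (min_le_left m₁ m₂)
        have z9 := hAnn (u x) hu
        refine mul_nonpos_of_nonneg_of_nonpos ?_ (by linarith)
        have e1 : 0 ≤ 2 * w x * β (u x) * γ (u x * w x) := by
          have := hβn (u x); have := hγn (u x * w x); positivity
        calc (0 : ℝ) ≤ -deriv β (w x) * (2 * w x * β (u x) * γ (u x * w x)) :=
              mul_nonneg (neg_nonneg.2 (hβd (w x))) e1
          _ = _ := by ring
    have hχ0 : 0 ≤ β (u x) * β (w x) * γ (u x * w x) :=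
      mul_nonneg (mul_nonneg (hβn _) (hβn _)) (hγn _)
    have hχ1 : β (u x) * β (w x) * γ (u x * w x) ≤ 1 :=
      mul_le_one₀ (mul_le_one₀ (hβl _) (hβn _) (hβl _)) (hγn _) (hγl _)
    have hG : deriv A (w x) * (-(2 * w x)) - deriv A (u x) * (2 * u x) < 0 := by
      rcases hu.lt_or_eq with h0 | h0
      · have := mul_pos (hApos (u x)) h0
        have := mul_nonneg (hApos (w x)).le hw
        linarith
      · have := mul_pos (hApos (w x)) (show 0 < w x by linarith)
        have := mul_nonneg (hApos (u x)).le hu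
        linarith
    generalize β (u x) * β (w x) * γ (u x * w x) = c at hχ0 hχ1 ⊢
    -- A convex combination of two negative numbers. The full derivative is the sum of `t1`, `t2`
    -- and `t3`, the contributions of γ' cancelling since J(uw) = 0.
    have t3 : (1 - c) * f' +
        c * (deriv A (w x) * (-(2 * w x)) - deriv A (u x) * (2 * u x)) < 0 := by
      rcases hχ0.lt_or_eq with h0 | h0
      · have := mul_neg_of_pos_of_neg h0 hG
        have := mul_nonpos_of_nonneg_of_nonpos (sub_nonneg.2 hχ1) hF'.le
        linarith
      · rw [← h0]; linarith
    linarith [t1, t2, t3]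

end

end Euclidean

/-! ### Smooth covector sections, differentials and local primitives. -/

section Manifold

variable {n : ℕ} {M : Type*} [TopologicalSpace M] [ChartedSpace (EuclideanSpace ℝ (Fin n)) M]
  [IsManifold (𝓡 n) ∞ M]

local notation "𝔼" => EuclideanSpace ℝ (Fin n)

theorem contMDiffAt_mfderiv_section {f : M → ℝ} {x : M} (hf : ContMDiffAt (𝓡 n) 𝓘(ℝ, ℝ) ∞ f x) :
    ContMDiffAt (𝓡 n) ((𝓡 n).prod 𝓘(ℝ, 𝔼 →L[ℝ] ℝ)) ∞
      (fun y => TotalSpace.mk' (𝔼 →L[ℝ] ℝ) (E := fun x : M => TangentSpace (𝓡 n) x →L[ℝ] ℝ) y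
        (mfderiv (𝓡 n) 𝓘(ℝ, ℝ) f y)) x := by
  refine (contMDiffAt_hom_bundle (E₁ := fun x : M => TangentSpace (𝓡 n) x)
    (E₂ := Bundle.Trivial M ℝ) _).2 ⟨contMDiffAt_id, ?_⟩
  refine (hf.mfderiv_const (m := ∞) (by simp)).congr_of_eventuallyEq ?_
  refine Eventually.of_forall fun y => ?_
  ext v
  simp [inTangentCoordinates, ContinuousLinearMap.inCoordinates]
  rfl

theorem contMDiffAt_tensor {a b : ∀ x : M, TangentSpace (𝓡 n) x →L[ℝ] ℝ} {x : M}
    (ha : ContMDiffAt (𝓡 n) ((𝓡 n).prod 𝓘(ℝ, 𝔼 →L[ℝ] ℝ)) ∞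
      (fun y => TotalSpace.mk' (𝔼 →L[ℝ] ℝ) (E := fun x : M => TangentSpace (𝓡 n) x →L[ℝ] ℝ) y
        (a y)) x)
    (hb : ContMDiffAt (𝓡 n) ((𝓡 n).prod 𝓘(ℝ, 𝔼 →L[ℝ] ℝ)) ∞
      (fun y => TotalSpace.mk' (𝔼 →L[ℝ] ℝ) (E := fun x : M => TangentSpace (𝓡 n) x →L[ℝ] ℝ) y
        (b y)) x) :
    ContMDiffAt (𝓡 n) ((𝓡 n).prod 𝓘(ℝ, 𝔼 →L[ℝ] 𝔼 →L[ℝ] ℝ)) ∞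
      (fun y => TotalSpace.mk' (𝔼 →L[ℝ] 𝔼 →L[ℝ] ℝ)
        (E := fun x : M => TangentSpace (𝓡 n) x →L[ℝ] TangentSpace (𝓡 n) x →L[ℝ] ℝ) y
        ((a y).smulRight (b y))) x := by
  refine (contMDiffAt_hom_bundle (E₁ := fun x : M => TangentSpace (𝓡 n) x)
    (E₂ := fun x : M => TangentSpace (𝓡 n) x →L[ℝ] Bundle.Trivial M ℝ x) _).2 ⟨contMDiffAt_id, ?_⟩
  have ha' := ((contMDiffAt_hom_bundle (E₁ := fun x : M => TangentSpace (𝓡 n) x)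
    (E₂ := Bundle.Trivial M ℝ) _).1 ha).2
  have hb' := ((contMDiffAt_hom_bundle (E₁ := fun x : M => TangentSpace (𝓡 n) x)
    (E₂ := Bundle.Trivial M ℝ) _).1 hb).2
  have hs : ContDiff ℝ ∞ fun z : (𝔼 →L[ℝ] ℝ) × (𝔼 →L[ℝ] ℝ) => z.1.smulRight z.2 :=
    contDiff_fst.smulRight contDiff_snd
  have := hs.contDiffAt.contMDiffAt.comp x (ha'.prodMk_space hb')
  refine this.congr_of_eventuallyEq ?_
  filter_upwards [(trivializationAt 𝔼 (fun x : M => TangentSpace (𝓡 n) x) x).open_baseSet.mem_nhds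
    (mem_baseSet_trivializationAt 𝔼 (fun x : M => TangentSpace (𝓡 n) x) x)] with y hy
  ext v w
  have hb'' : Trivialization.linearMapAt ℝ (trivializationAt (𝔼 →L[ℝ] ℝ)
      (fun x : M => TangentSpace (𝓡 n) x →L[ℝ] Bundle.Trivial M ℝ x) x) y (b y) =
      ContinuousLinearMap.inCoordinates 𝔼 (fun x : M => TangentSpace (𝓡 n) x) ℝ
        (Bundle.Trivial M ℝ) x y x y (b y) := by
    rw [Trivialization.coe_linearMapAt_of_mem _ (show y ∈ (trivializationAt (𝔼 →L[ℝ] ℝ)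
      (fun x : M => TangentSpace (𝓡 n) x →L[ℝ] Bundle.Trivial M ℝ x) x).baseSet from
        ⟨hy, mem_univ y⟩)]
    rfl
  have hbw := congrArg (fun φ : 𝔼 →L[ℝ] ℝ => φ w) hb''
  simp only [ContinuousLinearMap.inCoordinates] at hbw
  simp [ContinuousLinearMap.inCoordinates]
  left
  rw [hbw]
  simp

namespace OneForm

/-- The differential of a smooth function. -/
def differential (f : C^∞⟮𝓡 n, M; ℝ⟯) : OneForm n M :=
  ⟨fun x => mfderiv (𝓡 n) 𝓘(ℝ, ℝ) f x, fun x => contMDiffAt_mfderiv_section (f.contMDiff x)⟩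

theorem differential_apply (f : C^∞⟮𝓡 n, M; ℝ⟯) (x : M) (v : TangentSpace (𝓡 n) x) :
    differential f x v = mfderiv (𝓡 n) 𝓘(ℝ, ℝ) f x v := rfl

theorem inChart_differential (f : C^∞⟮𝓡 n, M; ℝ⟯) {e : OpenPartialHomeomorph M 𝔼}
    (he : e ∈ IsManifold.maximalAtlas (𝓡 n) ∞ M) {y : 𝔼} (hy : y ∈ e.target) :
    (differential f).inChart e y = fderiv ℝ (f ∘ e.symm) y := by
  have hs : MDifferentiableAt 𝓘(ℝ, 𝔼) (𝓡 n) e.symm y :=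
    ((contMDiffOn_symm_of_mem_maximalAtlas he).contMDiffAt
      (e.open_target.mem_nhds hy)).mdifferentiableAt (by simp)
  rw [← mfderiv_eq_fderiv, mfderiv_comp y (f.contMDiff.mdifferentiable (by simp) _) hs]
  rfl

set_option linter.unusedSectionVars false in
theorem contDiffOn_comp_symm (f : C^∞⟮𝓡 n, M; ℝ⟯) {e : OpenPartialHomeomorph M 𝔼}
    (he : e ∈ IsManifold.maximalAtlas (𝓡 n) ∞ M) : ContDiffOn ℝ ∞ (f ∘ e.symm) e.target := by
  rw [← contMDiffOn_iff_contDiffOn]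
  exact f.contMDiff.comp_contMDiffOn (contMDiffOn_symm_of_mem_maximalAtlas he)

/-- In a chart the form is the exterior derivative of a 0-form, and d² = 0. -/
theorem closed_differential (f : C^∞⟮𝓡 n, M; ℝ⟯) : (differential f).Closed := by
  intro e he y hy
  have h : (differential f).altInChart e =ᶠ[𝓝 y]
      extDeriv fun z => ContinuousAlternatingMap.constOfIsEmpty ℝ 𝔼 (Fin 0) ((f ∘ e.symm) z) := by
    filter_upwards [e.open_target.mem_nhds hy] with z hz
    rw [extDeriv_constOfIsEmpty, altInChart, inChart_differential f he hz]
  rw [h.extDeriv_eq]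
  refine extDeriv_extDeriv_apply (r := ∞) ?_
    (by simpa using WithTop.coe_le_coe.2 (le_top : (2 : ℕ∞) ≤ ⊤))
  have := (contDiffOn_comp_symm f he).contDiffAt (e.open_target.mem_nhds hy)
  exact (ContinuousAlternatingMap.constOfIsEmptyLIE ℝ 𝔼 ℝ
    (Fin 0)).toContinuousLinearEquiv.contDiff.contDiffAt.comp y this

/-- Poincaré lemma: evaluating dα = 0 on a pair of vectors says that the derivative of the
coefficient map is symmetric, which on a convex open set yields a primitive. It is smooth because
its derivative is. -/
theorem exists_primitive_inChart {α : OneForm n M} (hα : α.Closed) {e : OpenPartialHomeomorph M 𝔼}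
    (he : e ∈ IsManifold.maximalAtlas (𝓡 n) ∞ M) {s : Set 𝔼} (hs : IsOpen s) (hc : Convex ℝ s)
    (hse : s ⊆ e.target) :
    ∃ F : 𝔼 → ℝ, ContDiffOn ℝ ∞ F s ∧ ∀ y ∈ s, HasFDerivAt F (α.inChart e y) y := by
  have hsm : ContDiffOn ℝ ∞ (α.inChart e) s := (α.contDiffOn_inChart he).mono hse
  obtain ⟨F, hF⟩ := hc.exists_forall_hasFDerivAt_of_fderiv_symmetric hs
    (hsm.differentiableOn (by simp)) fun a ha x y => by
      have h := hα e he a (hse ha)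
      have hd := (hsm.differentiableOn (by simp)).differentiableAt (hs.mem_nhds ha)
      have h2 := congrArg (fun φ => φ ![x, y]) h
      simp only [extDeriv_apply (α.differentiableAt_altInChart he (hse ha))] at h2
      have key : ∀ v w : 𝔼, fderiv ℝ (fun z => α.altInChart e z (fun _ => w)) a v =
          fderiv ℝ (α.inChart e) a v w := by
        intro v w
        have : (fun z => α.altInChart e z (fun _ => w)) = fun z => α.inChart e z w := by
          ext z; simp [altInChart]
        rw [this]
        rw [(hd.hasFDerivAt.clm_apply (hasFDerivAt_const w a)).fderiv]
        simp
      have e0 : (0 : Fin 2).removeNth ![x, y] = fun _ => y := by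
        ext i; fin_cases i; rfl
      have e1 : (1 : Fin 2).removeNth ![x, y] = fun _ => x := by
        ext i; fin_cases i; rfl
      rw [Fin.sum_univ_two, e0, e1, key, key] at h2
      simp at h2
      linarith
  refine ⟨F, ?_, hF⟩
  rw [contDiffOn_infty_iff_fderiv_of_isOpen hs]
  exact ⟨fun y hy => (hF y hy).differentiableAt.differentiableWithinAt,
    hsm.congr fun y hy => (hF y hy).fderiv⟩

end OneForm

set_option linter.unusedSectionVars false in
theorem mfderiv_symm_mfderiv {e : OpenPartialHomeomorph M 𝔼}
    (he : e ∈ IsManifold.maximalAtlas (𝓡 n) ∞ M) {y : M} (hy : y ∈ e.source)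
    (v : TangentSpace (𝓡 n) y) :
    (mfderiv 𝓘(ℝ, 𝔼) (𝓡 n) e.symm (e y)) (mfderiv (𝓡 n) 𝓘(ℝ, 𝔼) e y v) = v := by
  have hs : MDifferentiableAt 𝓘(ℝ, 𝔼) (𝓡 n) e.symm (e y) :=
    ((contMDiffOn_symm_of_mem_maximalAtlas he).contMDiffAt
      (e.open_target.mem_nhds (e.map_source hy))).mdifferentiableAt (by simp)
  have he' : MDifferentiableAt (𝓡 n) 𝓘(ℝ, 𝔼) e y :=
    ((contMDiffOn_of_mem_maximalAtlas he).contMDiffAt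
      (e.open_source.mem_nhds hy)).mdifferentiableAt (by simp)
  have h1 : (e.symm ∘ e) =ᶠ[𝓝 y] id := by
    filter_upwards [e.open_source.mem_nhds hy] with z hz using e.left_inv hz
  have := mfderiv_comp y hs he'
  rw [h1.mfderiv_eq, mfderiv_id] at this
  exact (congrArg (fun φ : 𝔼 →L[ℝ] 𝔼 => φ v) this).symm

theorem contMDiffAt_clm_apply {a : ∀ x : M, TangentSpace (𝓡 n) x →L[ℝ] ℝ} {x : M}
    (ha : ContMDiffAt (𝓡 n) ((𝓡 n).prod 𝓘(ℝ, 𝔼 →L[ℝ] ℝ)) ∞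
      (fun y => TotalSpace.mk' (𝔼 →L[ℝ] ℝ) (E := fun x : M => TangentSpace (𝓡 n) x →L[ℝ] ℝ) y
        (a y)) x) (X : SmoothVectorField n M) :
    ContMDiffAt (𝓡 n) 𝓘(ℝ, ℝ) ∞ (fun y => a y (X y)) x := by
  have h := ContMDiffAt.clm_bundle_apply (F₁ := 𝔼) (F₂ := ℝ) (n := ∞)
    (E₁ := fun x : M => TangentSpace (𝓡 n) x) (E₂ := Bundle.Trivial M ℝ)
    ha (X.contMDiff x)
  exact (contMDiffAt_totalSpace.1 h).2

namespace OneForm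

theorem inChart_add (α η : OneForm n M) (e : OpenPartialHomeomorph M 𝔼) (y : 𝔼) :
    (α + η).inChart e y = α.inChart e y + η.inChart e y := by
  ext v
  simp [inChart]
  rfl

theorem add_apply_apply (α η : OneForm n M) (x : M) (v : TangentSpace (𝓡 n) x) :
    (α + η) x v = α x v + η x v := rfl

theorem inChart_mfderiv (α : OneForm n M) {e : OpenPartialHomeomorph M 𝔼}
    (he : e ∈ IsManifold.maximalAtlas (𝓡 n) ∞ M) {y : M} (hy : y ∈ e.source)
    (v : TangentSpace (𝓡 n) y) :
    α.inChart e (e y) (mfderiv (𝓡 n) 𝓘(ℝ, 𝔼) e y v) = α y v := by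
  -- The two covectors lie in fibres over points not definitionally equal; viewing every fibre as
  -- the dual of 𝔼 lets `left_inv` identify them.
  have h3 : (fun z : M => (α z : 𝔼 →L[ℝ] ℝ)) (e.symm (e y)) = (fun z : M => (α z : 𝔼 →L[ℝ] ℝ)) y :=
    congrArg _ (e.left_inv hy)
  change (α (e.symm (e y)) : 𝔼 →L[ℝ] ℝ)
    ((mfderiv 𝓘(ℝ, 𝔼) (𝓡 n) e.symm (e y)) (mfderiv (𝓡 n) 𝓘(ℝ, 𝔼) e y v)) = _
  rw [mfderiv_symm_mfderiv he hy]
  exact congrArg (fun φ : 𝔼 →L[ℝ] ℝ => φ v) h3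

theorem differential_eq_zero {f : C^∞⟮𝓡 n, M; ℝ⟯} {x : M} (hx : x ∉ tsupport f)
    (v : TangentSpace (𝓡 n) x) : differential f x v = 0 := by
  have h : (f : M → ℝ) =ᶠ[𝓝 x] fun _ => (0 : ℝ) := notMem_tsupport_iff_eventuallyEq.1 hx
  rw [differential_apply, h.mfderiv_eq, mfderiv_const]
  rfl

theorem IsStandardNear.add_differential {α : OneForm n M} {x : M} {q : ℕ}
    {e : OpenPartialHomeomorph M 𝔼} (hα : α.IsStandardNear x q e) {f : C^∞⟮𝓡 n, M; ℝ⟯}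
    (hx : x ∉ tsupport f) : (α + differential f).IsStandardNear x q e := by
  filter_upwards [hα, (isClosed_tsupport (f : M → ℝ)).isOpen_compl.mem_nhds hx] with y hy hyf v
  rw [add_apply_apply, differential_eq_zero hyf, add_zero, hy v]

theorem contMDiff_apply (α : OneForm n M) (X : SmoothVectorField n M) :
    ContMDiff (𝓡 n) 𝓘(ℝ, ℝ) ∞ fun x => α x (X x) :=
  fun x => contMDiffAt_clm_apply (α.contMDiff x) X

end OneForm

open OneForm

/-! ### Morse charts and standardization at the zeros. -/

namespace IsMorseChart

theorem mfderiv_vectorField {X : SmoothVectorField n M} {x : M} {q : ℕ}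
    {e : OpenPartialHomeomorph M 𝔼} (he : IsMorseChart X x q e) {y : M} (hy : y ∈ e.source) :
    mfderiv (𝓡 n) 𝓘(ℝ, 𝔼) e y (X y) = hyperbolic (fun i : Fin n => (i : ℕ) < q) (e y) := by
  refine PiLp.ext fun i => ?_
  exact he.vectorField_eq y hy i

theorem eq_of_apply_eq_zero {X : SmoothVectorField n M} {x : M} {q : ℕ}
    {e : OpenPartialHomeomorph M 𝔼} (he : IsMorseChart X x q e) {y : M} (hy : y ∈ e.source)
    (h : e y = 0) : y = x :=
  e.injOn hy he.mem_source (h.trans he.map_eq_zero.symm)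

theorem apply_eq_zero {X : SmoothVectorField n M} {x : M} {q : ℕ}
    {e : OpenPartialHomeomorph M 𝔼} (he : IsMorseChart X x q e) {y : M} (hy : y ∈ e.source)
    (h : X y = 0) :
    e y = 0 := by
  have := he.mfderiv_vectorField hy
  rw [h, map_zero] at this
  refine PiLp.ext fun i => ?_
  have hi := congrArg (fun v : 𝔼 => v i) this.symm
  change hyperbolic (fun i : Fin n => (i : ℕ) < q) (e y) i = 0 at hi
  rw [hyperbolic_apply] at hi
  split_ifs at hi
  · exact hi
  · exact neg_eq_zero.1 hi

end IsMorseChart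

/-- A Lyapunov form can be made standard near a Morse zero by adding the differential of a function
supported near that zero. -/
theorem IsLyapunovForm.exists_isStandardNear [T2Space M] {X : SmoothVectorField n M}
    {α : OneForm n M} (hα : IsLyapunovForm X α) {x : M} (hx : X x = 0) {q : ℕ}
    {e : OpenPartialHomeomorph M 𝔼} (he : IsMorseChart X x q e) {U : Set M} (hU : U ∈ 𝓝 x) :
    ∃ f : C^∞⟮𝓡 n, M; ℝ⟯, tsupport f ⊆ U ∧ IsLyapunovForm X (α + differential f) ∧
      (α + differential f).IsStandardNear x q e := by
  have hat := he.mem_maximalAtlas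
  have h0t : (0 : 𝔼) ∈ e.target := he.map_eq_zero ▸ e.map_source he.mem_source
  have hs0 : e.symm 0 = x := by rw [← he.map_eq_zero, e.left_inv he.mem_source]
  obtain ⟨r, hr, hball⟩ : ∃ r > 0, Metric.ball (0 : 𝔼) r ⊆ e.target ∩ e.symm ⁻¹' U := by
    rw [← Metric.mem_nhds_iff]
    exact inter_mem (e.open_target.mem_nhds h0t)
      ((e.symm.continuousAt h0t).preimage_mem_nhds (by rwa [hs0]))
  have hbt : Metric.ball (0 : 𝔼) r ⊆ e.target := fun y hy => (hball hy).1
  obtain ⟨F₀, hF₀, hF₀'⟩ := exists_primitive_inChart hα.1 hat Metric.isOpen_ball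
    (convex_ball (0 : 𝔼) r) hbt
  have hF' : ∀ y ∈ Metric.ball (0 : 𝔼) r,
      HasFDerivAt (fun y => F₀ y - F₀ 0) (α.inChart e y) y :=
    fun y hy => (hF₀' y hy).sub_const _
  obtain ⟨h, hh, hhb, hhQ, hhd⟩ := exists_standardization_of_fderiv_hyperbolic_neg
    (p := fun i : Fin n => (i : ℕ) < q) (F := fun y => F₀ y - F₀ 0) hr
    (hF₀.sub contDiffOn_const) (sub_self _) (fun y hy hy0 => by
      have hys := e.map_target (hbt hy)
      have hee := e.right_inv (hbt hy)
      have h1 := α.inChart_mfderiv hat hys (X (e.symm y))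
      rw [he.mfderiv_vectorField hys, hee] at h1
      rw [(hF' y hy).fderiv]
      refine h1.trans_lt (hα.2 _ fun hX => hy0 ?_)
      rw [← hee, he.apply_eq_zero hys hX])
  have hcomp : IsCompact (tsupport h) :=
    Metric.isCompact_of_isClosed_isBounded (isClosed_tsupport h) (Metric.isBounded_ball.subset hhb)
  set K : Set M := e.symm '' tsupport h with hK
  have hKc : IsClosed K :=
    (hcomp.image_of_continuousOn (e.continuousOn_symm.mono (hhb.trans hbt))).isClosed
  classical
  -- Extension by zero is smooth because K, compact in a Hausdorff space, is closed and lies in the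
  -- chart domain.
  let f₀ : M → ℝ := fun z => if z ∈ e.source then h (e z) else 0
  have hf₀K : ∀ z, z ∉ K → f₀ z = 0 := by
    intro z hz
    simp only [f₀]
    split_ifs with hzs
    · by_contra hne
      exact hz ⟨e z, subset_tsupport h hne, e.left_inv hzs⟩
    · rfl
  have hKs : K ⊆ e.source := by
    rintro _ ⟨y, hy, rfl⟩
    exact e.map_target (hbt (hhb hy))
  have hKb : ∀ z ∈ K, e z ∈ Metric.ball (0 : 𝔼) r := by
    rintro _ ⟨y, hy, rfl⟩
    rw [e.right_inv (hbt (hhb hy))]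
    exact hhb hy
  have hf₀ : ContMDiff (𝓡 n) 𝓘(ℝ, ℝ) ∞ f₀ := by
    intro z
    by_cases hz : z ∈ e.source
    · have : f₀ =ᶠ[𝓝 z] h ∘ e := by
        filter_upwards [e.open_source.mem_nhds hz] with z' hz' using if_pos hz'
      refine ContMDiffAt.congr_of_eventuallyEq ?_ this
      exact hh.contMDiff.contMDiffAt.comp z
        ((contMDiffOn_of_mem_maximalAtlas hat).contMDiffAt (e.open_source.mem_nhds hz))
    · have : f₀ =ᶠ[𝓝 z] fun _ => 0 := by
        filter_upwards [hKc.isOpen_compl.mem_nhds fun hz' => hz (hKs hz')] with z' hz'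
          using hf₀K z' hz'
      exact contMDiffAt_const.congr_of_eventuallyEq this
  let f : C^∞⟮𝓡 n, M; ℝ⟯ := ⟨f₀, hf₀⟩
  have hfK : tsupport f ⊆ K := closure_minimal (fun z hz => by
    by_contra hzK
    exact hz (hf₀K z hzK)) hKc
  have hfin : ∀ y ∈ e.target, (differential f).inChart e y = fderiv ℝ h y := by
    intro y hy
    rw [inChart_differential f hat hy]
    refine Filter.EventuallyEq.fderiv_eq ?_
    filter_upwards [e.open_target.mem_nhds hy] with y' hy'
    change f₀ (e.symm y') = h y'
    simp only [f₀, if_pos (e.map_target hy'), e.right_inv hy']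
  refine ⟨f, ?_, ⟨?_, fun z hz => ?_⟩, ?_⟩
  · refine hfK.trans ?_
    rintro _ ⟨y, hy, rfl⟩
    exact (hball (hhb hy)).2
  · exact (closedForms n M).add_mem hα.1 (closed_differential f)
  · by_cases hzK : z ∈ K
    · have hzs := hKs hzK
      rw [← inChart_mfderiv _ hat hzs, he.mfderiv_vectorField hzs, inChart_add,
        hfin _ (e.map_source hzs), ← (hF' _ (hKb z hzK)).fderiv]
      refine hhd _ (hKb z hzK) fun h0 => hz ?_
      rw [he.eq_of_apply_eq_zero hzs h0, hx]
    · rw [add_apply_apply, differential_eq_zero fun hz' => hzK (hfK hz'), add_zero]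
      exact hα.2 z hz
  · have hex : Tendsto e (𝓝 x) (𝓝 0) := by
      have := e.continuousAt he.mem_source
      rwa [ContinuousAt, he.map_eq_zero] at this
    filter_upwards [e.open_source.mem_nhds he.mem_source, hex.eventually hhQ.eventually_nhds,
      hex.eventually (Metric.ball_mem_nhds (0 : 𝔼) hr)] with z hzs hzQ hzb v
    have hd : HasFDerivAt (fun y => F₀ y - F₀ 0 + h y)
        ((α + differential f).inChart e (e z)) (e z) := by
      rw [inChart_add, hfin _ (hbt hzb)]
      exact (hF' _ hzb).add (hh.differentiable (by simp) _).hasFDerivAt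
    rw [← inChart_mfderiv _ hat hzs, ← hd.fderiv, Filter.EventuallyEq.fderiv_eq hzQ]
    have hu := ((contDiff_partialSq fun i : Fin n => (i : ℕ) < q).differentiable
      (by simp) (e z)).hasFDerivAt
    have hw := ((contDiff_partialSq fun i : Fin n => ¬ (i : ℕ) < q).differentiable
      (by simp) (e z)).hasFDerivAt
    have hQ := (hw.sub hu).mul_const (2⁻¹ : ℝ)
    have hQ' : HasFDerivAt (fun y : 𝔼 => (partialSq (fun i : Fin n => ¬ (i : ℕ) < q) y -
      partialSq (fun i : Fin n => (i : ℕ) < q) y) / 2) _ (e z) := hQ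
    have key : ∀ v' : 𝔼, ((2⁻¹ : ℝ) • (fderiv ℝ (partialSq fun i : Fin n => ¬ (i : ℕ) < q) (e z) -
        fderiv ℝ (partialSq fun i : Fin n => (i : ℕ) < q) (e z)) : 𝔼 →L[ℝ] ℝ) v' =
        2⁻¹ * (2 * (∑ i : Fin n, if ¬ (i : ℕ) < q then e z i * v' i else 0) -
          2 * ∑ i : Fin n, if (i : ℕ) < q then e z i * v' i else 0) := fun v' => by
      rw [smul_apply, sub_apply, fderiv_partialSq, fderiv_partialSq, smul_eq_mul]
    rw [hQ'.fderiv]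
    refine (key _).trans ?_
    change 2⁻¹ * (2 * (∑ i : Fin n, if ¬ (i : ℕ) < q then e z i * coordDiff e i z v else 0) -
      2 * ∑ i : Fin n, if (i : ℕ) < q then e z i * coordDiff e i z v else 0) = _
    simp only [ite_not]
    ring

/-- The zero set is {α(X) ≥ 0}, hence compact, and each Morse chart contains only its own centre as
a zero. -/
theorem IsLyapunovForm.finite_zeros [CompactSpace M] {X : SmoothVectorField n M}
    {α : OneForm n M} (hα : IsLyapunovForm X α) {q : M → ℕ} {e : M → OpenPartialHomeomorph M 𝔼}
    (he : ∀ x, X x = 0 → IsMorseChart X x (q x) (e x)) : {x : M | X x = 0}.Finite := by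
  have hcl : IsClosed {x : M | X x = 0} := by
    have : {x : M | X x = 0} = (fun x => α x (X x)) ⁻¹' Ici 0 := by
      ext x
      constructor
      · intro h
        have h' : X x = 0 := h
        simp [h']
      · intro h
        by_contra hne
        exact absurd (hα.2 x hne) (not_lt.2 h)
    rw [this]
    exact isClosed_Ici.preimage (α.contMDiff_apply X).continuous
  obtain ⟨t, ht, htc⟩ := hcl.isCompact.elim_nhds_subcover (fun x => (e x).source)
    fun x hx => (e x).open_source.mem_nhds (he x hx).mem_source
  refine t.finite_toSet.subset fun y hy => ?_
  obtain ⟨x, hxt, hyx⟩ := mem_iUnion₂.1 (htc hy)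
  have hxm := he x (ht x hxt)
  rw [hxm.eq_of_apply_eq_zero hyx (hxm.apply_eq_zero hyx hy)]
  exact hxt

/-- A Lyapunov form can be changed by an exact form to be standard near all zeros. -/
theorem IsLyapunovForm.exists_isStandardNear_zeros [T2Space M] [CompactSpace M]
    {X : SmoothVectorField n M} {α : OneForm n M} (hα : IsLyapunovForm X α) {q : M → ℕ}
    {e : M → OpenPartialHomeomorph M 𝔼} (he : ∀ x, X x = 0 → IsMorseChart X x (q x) (e x)) :
    ∃ f : C^∞⟮𝓡 n, M; ℝ⟯, IsLyapunovForm X (α + differential f) ∧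
      ∀ x, X x = 0 → (α + differential f).IsStandardNear x (q x) (e x) := by
  classical
  suffices H : ∀ S : Finset M, (∀ x ∈ S, X x = 0) → ∃ f : C^∞⟮𝓡 n, M; ℝ⟯,
      IsLyapunovForm X (α + differential f) ∧
      ∀ x ∈ S, (α + differential f).IsStandardNear x (q x) (e x) by
    obtain ⟨f, hf, hf'⟩ := H (hα.finite_zeros he).toFinset fun x hx => by simpa using hx
    exact ⟨f, hf, fun x hx => hf' x (by simpa using hx)⟩
  intro S
  have hadd : ∀ f g : C^∞⟮𝓡 n, M; ℝ⟯, differential (f + g) = differential f + differential g := by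
    intro f g
    refine ContMDiffSection.ext fun x => ?_
    exact mfderiv_add (f.contMDiff.mdifferentiable (by simp) x)
      (g.contMDiff.mdifferentiable (by simp) x)
  induction S using Finset.induction_on with
  | empty =>
    intro _
    have h0 : differential (0 : C^∞⟮𝓡 n, M; ℝ⟯) = 0 := by
      have := hadd 0 0
      rwa [add_zero, left_eq_add] at this
    exact ⟨0, by rwa [h0, add_zero], by simp⟩
  | insert a S ha ih =>
    intro hS
    obtain ⟨f, hf, hfS⟩ := ih fun x hx => hS x (Finset.mem_insert_of_mem hx)
    have haX := hS a (Finset.mem_insert_self a S)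
    -- Supporting the correction off S leaves the form unchanged near the zeros already treated.
    obtain ⟨g, hg, hg1, hg2⟩ := hf.exists_isStandardNear haX (he a haX)
      (S.finite_toSet.isClosed.isOpen_compl.mem_nhds (by simpa using ha))
    refine ⟨f + g, by rwa [hadd, ← add_assoc], fun x hx => ?_⟩
    rw [hadd, ← add_assoc]
    rcases Finset.mem_insert.1 hx with rfl | hx
    · exact hg2
    · exact (hfS x hx).add_differential fun h => hg h (by simpa using hx)

/-! ### Riemannian metrics dual to a Lyapunov form. -/

theorem isVonNBounded_setOf_lt_one
    (B : EuclideanSpace ℝ (Fin n) →L[ℝ] EuclideanSpace ℝ (Fin n) →L[ℝ] ℝ)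
    (hB : ∀ v, v ≠ 0 → 0 < B v v) : Bornology.IsVonNBounded ℝ {v | B v v < 1} := by
  rw [NormedSpace.isVonNBounded_iff]
  have hcont : Continuous fun v : 𝔼 => B v v := by fun_prop
  -- Compactness of the sphere gives B(v, v) ≥ c‖v‖², which bounds the unit ball of B.
  obtain ⟨c, hc, hcB⟩ := (isCompact_sphere (0 : 𝔼) 1).exists_forall_le' hcont.continuousOn (a := 0)
    fun v hv => hB v (by rintro rfl; simp at hv)
  refine (Metric.isBounded_closedBall (x := (0 : 𝔼)) (r := 1 / c + 1)).subset fun v hv => ?_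
  rw [mem_closedBall_zero_iff]
  rcases eq_or_ne v 0 with rfl | hv0
  · rw [norm_zero]; positivity
  have hvn : 0 < ‖v‖ := norm_pos_iff.2 hv0
  have h1 := hcB (‖v‖⁻¹ • v) (by simp [norm_smul, hvn.ne'])
  simp only [map_smul, smul_apply, smul_eq_mul] at h1
  have h2 : B v v < 1 := hv
  have h3 : c * ‖v‖ ^ 2 < 1 := by
    calc c * ‖v‖ ^ 2 ≤ (‖v‖⁻¹ * (‖v‖⁻¹ * B v v)) * ‖v‖ ^ 2 := by gcongr
      _ = B v v := by field_simp
      _ < 1 := h2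
  have h4 : ‖v‖ ^ 2 < 1 / c := by rw [lt_div_iff₀ hc]; linarith
  nlinarith

/-- The differential of the `i`-th coordinate function of a chart. -/
def coordForm (e : OpenPartialHomeomorph M (EuclideanSpace ℝ (Fin n))) (i : Fin n) (y : M) :
    TangentSpace (𝓡 n) y →L[ℝ] ℝ :=
  mfderiv (𝓡 n) 𝓘(ℝ, ℝ) (fun z => e z i) y

section

variable {e : OpenPartialHomeomorph M (EuclideanSpace ℝ (Fin n))}

set_option linter.unusedSectionVars false in
theorem coordForm_apply (he : e ∈ IsManifold.maximalAtlas (𝓡 n) ∞ M) {y : M} (hy : y ∈ e.source)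
    (i : Fin n) (v : TangentSpace (𝓡 n) y) : coordForm e i y v = coordDiff e i y v := by
  have he' : MDifferentiableAt (𝓡 n) 𝓘(ℝ, 𝔼) e y :=
    ((contMDiffOn_of_mem_maximalAtlas he).contMDiffAt
      (e.open_source.mem_nhds hy)).mdifferentiableAt (by simp)
  have h := (EuclideanSpace.proj (𝕜 := ℝ) i : 𝔼 →L[ℝ] ℝ).hasMFDerivAt.comp y he'.hasMFDerivAt
  have h' : mfderiv (𝓡 n) 𝓘(ℝ, ℝ) (fun z => e z i) y = _ := h.mfderiv
  rw [coordForm, h']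
  rfl

theorem contMDiffAt_coordForm (he : e ∈ IsManifold.maximalAtlas (𝓡 n) ∞ M) {y : M}
    (hy : y ∈ e.source) (i : Fin n) :
    ContMDiffAt (𝓡 n) ((𝓡 n).prod 𝓘(ℝ, 𝔼 →L[ℝ] ℝ)) ∞
      (fun y => TotalSpace.mk' (𝔼 →L[ℝ] ℝ) (E := fun x : M => TangentSpace (𝓡 n) x →L[ℝ] ℝ) y
        (coordForm e i y)) y :=
  contMDiffAt_mfderiv_section
    ((EuclideanSpace.proj (𝕜 := ℝ) i : 𝔼 →L[ℝ] ℝ).contMDiff.contMDiffAt.comp y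
      ((contMDiffOn_of_mem_maximalAtlas he).contMDiffAt (e.open_source.mem_nhds hy)))

theorem eq_zero_of_coordDiff_eq_zero (he : e ∈ IsManifold.maximalAtlas (𝓡 n) ∞ M) {y : M}
    (hy : y ∈ e.source) {v : TangentSpace (𝓡 n) y} (hv : ∀ i, coordDiff e i y v = 0) : v = 0 := by
  have h0 : mfderiv (𝓡 n) 𝓘(ℝ, 𝔼) e y v = 0 := PiLp.ext hv
  rw [← mfderiv_symm_mfderiv he hy v, h0, map_zero]
  rfl

variable (e) in
/-- The bilinear form `∑ᵢ (dxᵢ)²` of a chart. -/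
def euclideanTensor (y : M) : TangentSpace (𝓡 n) y →L[ℝ] TangentSpace (𝓡 n) y →L[ℝ] ℝ :=
  ∑ i, (coordForm e i y).smulRight (coordForm e i y)

theorem euclideanTensor_apply (he : e ∈ IsManifold.maximalAtlas (𝓡 n) ∞ M) {y : M}
    (hy : y ∈ e.source) (v w : TangentSpace (𝓡 n) y) :
    euclideanTensor e y v w = ∑ i, coordDiff e i y v * coordDiff e i y w := by
  simp [euclideanTensor, sum_apply, coordForm_apply he hy]

theorem contMDiffAt_euclideanTensor (he : e ∈ IsManifold.maximalAtlas (𝓡 n) ∞ M) {y : M}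
    (hy : y ∈ e.source) :
    ContMDiffAt (𝓡 n) ((𝓡 n).prod 𝓘(ℝ, 𝔼 →L[ℝ] 𝔼 →L[ℝ] ℝ)) ∞
      (fun y => TotalSpace.mk' (𝔼 →L[ℝ] 𝔼 →L[ℝ] ℝ)
        (E := fun x : M => TangentSpace (𝓡 n) x →L[ℝ] TangentSpace (𝓡 n) x →L[ℝ] ℝ) y
        (euclideanTensor e y)) y :=
  ContMDiffAt.sum_section fun i _ =>
    contMDiffAt_tensor (contMDiffAt_coordForm he hy i) (contMDiffAt_coordForm he hy i)

theorem euclideanTensor_pos (he : e ∈ IsManifold.maximalAtlas (𝓡 n) ∞ M) {y : M}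
    (hy : y ∈ e.source) {v : TangentSpace (𝓡 n) y} (hv : v ≠ 0) : 0 < euclideanTensor e y v v := by
  rw [euclideanTensor_apply he hy]
  refine lt_of_le_of_ne (Finset.sum_nonneg fun i _ => mul_self_nonneg _) fun h => hv ?_
  refine eq_zero_of_coordDiff_eq_zero he hy fun i => ?_
  exact mul_self_eq_zero.1 ((Finset.sum_eq_zero_iff_of_nonneg
    fun i _ => mul_self_nonneg (coordDiff e i y v)).1 h.symm i (Finset.mem_univ i))

end

/-- The component of `coordForm e i` vanishing on `X`, along the splitting of the tangent space into
the line spanned by `X` and the kernel of `α`. -/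
def transverseForm (X : SmoothVectorField n M) (α : OneForm n M)
    (e : OpenPartialHomeomorph M (EuclideanSpace ℝ (Fin n))) (i : Fin n) (y : M) :
    TangentSpace (𝓡 n) y →L[ℝ] ℝ :=
  coordForm e i y - (coordForm e i y (X y) * (α y (X y))⁻¹) • α y

/-- A metric with `α = -g(X, ·)` on the part of the domain of `e` where `α(X) < 0`. -/
def dualTensor (X : SmoothVectorField n M) (α : OneForm n M)
    (e : OpenPartialHomeomorph M (EuclideanSpace ℝ (Fin n))) (y : M) :
    TangentSpace (𝓡 n) y →L[ℝ] TangentSpace (𝓡 n) y →L[ℝ] ℝ :=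
  (∑ i, (transverseForm X α e i y).smulRight (transverseForm X α e i y)) -
    (α y (X y))⁻¹ • (α y).smulRight (α y)

section

variable {X : SmoothVectorField n M} {α : OneForm n M}
  {e : OpenPartialHomeomorph M (EuclideanSpace ℝ (Fin n))}

theorem transverseForm_apply (i : Fin n) (y : M) (v : TangentSpace (𝓡 n) y) :
    transverseForm X α e i y v =
      coordForm e i y v - coordForm e i y (X y) * (α y (X y))⁻¹ * α y v := rfl

theorem dualTensor_apply (y : M) (v w : TangentSpace (𝓡 n) y) :
    dualTensor X α e y v w =
      ∑ i, transverseForm X α e i y v * transverseForm X α e i y w -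
        (α y (X y))⁻¹ * (α y v * α y w) := by
  simp [dualTensor, sum_apply]

theorem dualTensor_symm (y : M) (v w : TangentSpace (𝓡 n) y) :
    dualTensor X α e y v w = dualTensor X α e y w v := by
  rw [dualTensor_apply, dualTensor_apply, mul_comm (α y v)]
  congr 1
  exact Finset.sum_congr rfl fun i _ => mul_comm _ _

theorem dualTensor_vectorField {y : M} (hy : α y (X y) ≠ 0) (v : TangentSpace (𝓡 n) y) :
    dualTensor X α e y (X y) v = -(α y v) := by
  have h : ∀ i, transverseForm X α e i y (X y) = 0 := fun i => by
    rw [transverseForm_apply, mul_assoc, inv_mul_cancel₀ hy, mul_one, sub_self]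
  simp only [dualTensor_apply, h, zero_mul, Finset.sum_const_zero, zero_sub]
  rw [← mul_assoc, inv_mul_cancel₀ hy, one_mul]

/-- The α ⊗ α term has a positive coefficient, and on ker α the transverse forms reduce to the
coordinate differentials, which separate vectors. -/
theorem dualTensor_pos (he : e ∈ IsManifold.maximalAtlas (𝓡 n) ∞ M) {y : M} (hy : y ∈ e.source)
    (hα : α y (X y) < 0) {v : TangentSpace (𝓡 n) y} (hv : v ≠ 0) : 0 < dualTensor X α e y v v := by
  rw [dualTensor_apply]
  have h1 : 0 ≤ ∑ i, transverseForm X α e i y v * transverseForm X α e i y v :=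
    Finset.sum_nonneg fun i _ => mul_self_nonneg _
  have hinv : (α y (X y))⁻¹ < 0 := inv_lt_zero.2 hα
  rcases eq_or_ne (α y v) 0 with h0 | h0
  · rw [h0, mul_zero, mul_zero, sub_zero]
    refine lt_of_le_of_ne h1 fun h => hv ?_
    refine eq_zero_of_coordDiff_eq_zero he hy fun i => ?_
    have hi := mul_self_eq_zero.1 ((Finset.sum_eq_zero_iff_of_nonneg
      fun i _ => mul_self_nonneg (transverseForm X α e i y v)).1 h.symm i (Finset.mem_univ i))
    rwa [transverseForm_apply, h0, mul_zero, sub_zero, coordForm_apply he hy] at hi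
  · have := mul_neg_of_neg_of_pos hinv (mul_self_pos.2 h0)
    linarith

theorem contMDiffAt_dualTensor (he : e ∈ IsManifold.maximalAtlas (𝓡 n) ∞ M) {y : M}
    (hy : y ∈ e.source) (hα : α y (X y) ≠ 0) :
    ContMDiffAt (𝓡 n) ((𝓡 n).prod 𝓘(ℝ, 𝔼 →L[ℝ] 𝔼 →L[ℝ] ℝ)) ∞
      (fun y => TotalSpace.mk' (𝔼 →L[ℝ] 𝔼 →L[ℝ] ℝ)
        (E := fun x : M => TangentSpace (𝓡 n) x →L[ℝ] TangentSpace (𝓡 n) x →L[ℝ] ℝ) y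
        (dualTensor X α e y)) y := by
  have hinv : ContMDiffAt (𝓡 n) 𝓘(ℝ, ℝ) ∞ (fun y => (α y (X y))⁻¹) y :=
    ((contDiffAt_inv ℝ hα).contMDiffAt).comp y (α.contMDiff_apply X y)
  have hθ : ∀ i, ContMDiffAt (𝓡 n) ((𝓡 n).prod 𝓘(ℝ, 𝔼 →L[ℝ] ℝ)) ∞
      (fun y => TotalSpace.mk' (𝔼 →L[ℝ] ℝ) (E := fun x : M => TangentSpace (𝓡 n) x →L[ℝ] ℝ) y
        (transverseForm X α e i y)) y := fun i =>
    (contMDiffAt_coordForm he hy i).sub_section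
      (((contMDiffAt_clm_apply (contMDiffAt_coordForm he hy i) X).mul hinv).smul_section
        (α.contMDiff y))
  exact (ContMDiffAt.sum_section fun i _ => contMDiffAt_tensor (hθ i) (hθ i)).sub_section
    (hinv.smul_section (contMDiffAt_tensor (α.contMDiff y) (α.contMDiff y)))

end

set_option maxHeartbeats 2000000 in
set_option synthInstance.maxHeartbeats 400000 in
/-- A Lyapunov form which is standard near the zeros of `X` is `-g(X, ·)` for a Riemannian metric
`g` which is Euclidean near the zeros. -/
theorem IsLyapunovForm.exists_isNegDual [T2Space M] [CompactSpace M] {X : SmoothVectorField n M}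
    {α : OneForm n M} (hα : IsLyapunovForm X α) {q : M → ℕ}
    {e : M → OpenPartialHomeomorph M (EuclideanSpace ℝ (Fin n))}
    (he : ∀ x, X x = 0 → IsMorseChart X x (q x) (e x))
    (hstd : ∀ x, X x = 0 → α.IsStandardNear x (q x) (e x)) :
    ∃ g : SmoothRiemannianMetric n M, IsNegDual X α g ∧
      ∀ x, X x = 0 → IsEuclideanNear g x (e x) := by
  have hfin := hα.finite_zeros he
  obtain ⟨U, hU, hUd⟩ := hfin.t2_separation
  -- On V z the form is standard, and different zeros have disjoint V z. The Euclidean condition is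
  -- imposed only on the smaller closed N z, so that the complement of their finite union is open.
  let V : M → Set M := fun z => U z ∩ (e z).source ∩ interior {y | ∀ v : TangentSpace (𝓡 n) y,
    α y v = -(∑ i : Fin n, if (i : ℕ) < q z then e z y i * coordDiff (e z) i y v else 0) +
      ∑ i : Fin n, if (i : ℕ) < q z then 0 else e z y i * coordDiff (e z) i y v}
  have hVo : ∀ z, IsOpen (V z) := fun z =>
    ((hU z).2.inter (e z).open_source).inter isOpen_interior
  have hVz : ∀ z, X z = 0 → V z ∈ 𝓝 z := fun z hz =>
    (hVo z).mem_nhds ⟨⟨(hU z).1, (he z hz).mem_source⟩, mem_interior_iff_mem_nhds.2 (hstd z hz)⟩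
  have hN : ∀ z, ∃ N : Set M, X z = 0 → N ∈ 𝓝 z ∧ IsClosed N ∧ N ⊆ V z := fun z => by
    by_cases hz : X z = 0
    · obtain ⟨N, h1, h2, h3⟩ := exists_mem_nhds_isClosed_subset (hVz z hz)
      exact ⟨N, fun _ => ⟨h1, h2, h3⟩⟩
    · exact ⟨∅, fun h => absurd h hz⟩
  choose N hN using hN
  let t : ∀ y : M, Set (TangentSpace (𝓡 n) y →L[ℝ] TangentSpace (𝓡 n) y →L[ℝ] ℝ) := fun y =>
    {G | (∀ v w, G v w = G w v) ∧ (∀ v, v ≠ 0 → 0 < G v v) ∧ (∀ v, α y v = -(G (X y) v)) ∧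
      ∀ z, X z = 0 → y ∈ N z → ∀ v w, G v w = ∑ i, coordDiff (e z) i y v * coordDiff (e z) i y w}
  have ht : ∀ y, Convex ℝ (t y) := by
    rintro y G ⟨g1, g2, g3, g4⟩ H ⟨h1, h2, h3, h4⟩ a b ha hb hab
    have happ : ∀ v w, (a • G + b • H) v w = a * G v w + b * H v w := fun v w => rfl
    refine ⟨fun v w => ?_, fun v hv => ?_, fun v => ?_, fun z hz hy v w => ?_⟩
    · rw [happ, happ, g1 v w, h1 v w]
    · rw [happ]
      have := g2 v hv
      have := h2 v hv
      rcases ha.lt_or_eq with h | h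
      · positivity
      · have : b = 1 := by linarith
        subst this
        rw [← h]; linarith
    · rw [happ]
      have e1 : G (X y) v = -(α y v) := by rw [g3 v, neg_neg]
      have e2 : H (X y) v = -(α y v) := by rw [h3 v, neg_neg]
      rw [e1, e2, ← add_mul, hab, one_mul, neg_neg]
    · rw [happ, g4 z hz hy, h4 z hz hy, ← add_mul, hab, one_mul]
  obtain ⟨s, hs⟩ := exists_contMDiffSection_forall_mem_convex_of_local (n := ⊤) (𝓡 n)
    (F_fiber := 𝔼 →L[ℝ] 𝔼 →L[ℝ] ℝ)
    (fun x : M => TangentSpace (𝓡 n) x →L[ℝ] TangentSpace (𝓡 n) x →L[ℝ] ℝ) t ht fun y₀ => by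
      by_cases hy₀ : ∃ z, X z = 0 ∧ y₀ ∈ N z
      · obtain ⟨z, hz, hyz⟩ := hy₀
        have hat := (he z hz).mem_maximalAtlas
        refine ⟨V z, (hVo z).mem_nhds ((hN z hz).2.2 hyz), euclideanTensor (e z),
          fun y hy => (contMDiffAt_euclideanTensor hat hy.1.2).contMDiffWithinAt, fun y hy => ?_⟩
        refine ⟨fun v w => ?_, fun v hv => euclideanTensor_pos hat hy.1.2 hv, fun v => ?_,
          fun z' hz' hy' v w => ?_⟩
        · rw [euclideanTensor_apply hat hy.1.2, euclideanTensor_apply hat hy.1.2]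
          exact Finset.sum_congr rfl fun i _ => mul_comm _ _
        · rw [euclideanTensor_apply hat hy.1.2, interior_subset hy.2 v, ← Finset.sum_neg_distrib,
            ← Finset.sum_neg_distrib, ← Finset.sum_add_distrib]
          refine Finset.sum_congr rfl fun i _ => ?_
          rw [(he z hz).vectorField_eq y hy.1.2 i]
          split_ifs <;> ring
        -- Disjointness ensures that only one chart imposes its Euclidean condition here.
        · have hzz : z = z' := by
            by_contra hne
            exact Set.disjoint_left.1 (hUd hz hz' hne) hy.1.1 ((hN z' hz').2.2 hy').1.1
          subst hzz
          exact euclideanTensor_apply hat hy.1.2 v w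
      · push Not at hy₀
        have hX : X y₀ ≠ 0 := fun h => hy₀ y₀ h (mem_of_mem_nhds (hN y₀ h).1)
        have hat : chartAt 𝔼 y₀ ∈ IsManifold.maximalAtlas (𝓡 n) ∞ M :=
          IsManifold.chart_mem_maximalAtlas y₀
        have hNc : IsClosed (⋃ z ∈ {x | X x = 0}, N z) :=
          hfin.isClosed_biUnion fun z hz => (hN z hz).2.1
        refine ⟨(chartAt 𝔼 y₀).source ∩ (fun y => α y (X y)) ⁻¹' Iio 0 ∩
            (⋃ z ∈ {x | X x = 0}, N z)ᶜ, ?_, dualTensor X α (chartAt 𝔼 y₀),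
          fun y hy => (contMDiffAt_dualTensor hat hy.1.1 hy.1.2.ne).contMDiffWithinAt,
          fun y hy => ?_⟩
        · refine IsOpen.mem_nhds (((chartAt 𝔼 y₀).open_source.inter
            (isOpen_Iio.preimage (α.contMDiff_apply X).continuous)).inter hNc.isOpen_compl)
            ⟨⟨mem_chart_source 𝔼 y₀, hα.2 y₀ hX⟩, ?_⟩
          simpa using hy₀
        · refine ⟨dualTensor_symm y, fun v hv => dualTensor_pos hat hy.1.1 hy.1.2 hv, fun v => ?_,
            fun z hz hyz => absurd (mem_iUnion₂.2 ⟨z, hz, hyz⟩) hy.2⟩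
          rw [dualTensor_vectorField hy.1.2.ne, neg_neg]
  refine ⟨⟨fun y => s y, fun y => (hs y).1, fun y => (hs y).2.1,
    fun y => isVonNBounded_setOf_lt_one _ (hs y).2.1, s.contMDiff⟩, fun y => (hs y).2.2.1,
    fun z hz => ?_⟩
  filter_upwards [(hN z hz).1] with y hy
  exact (hs y).2.2.2 z hz hy

end Manifold

end

/-! ### Assembly of the two modifications. -/

theorem propositionP {n : ℕ} {M : Type*} [TopologicalSpace M] [T2Space M] [CompactSpace M]
    [ChartedSpace (EuclideanSpace ℝ (Fin n)) M] [IsManifold (𝓡 n) ∞ M]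
    (X : SmoothVectorField n M) (hX : ∀ x : M, X x = 0 → IsMorseZero X x)
    (ξ : DeRhamH1 n M) (hξ : IsLyapunovClass X ξ) :
    (∃ (α : OneForm.closedForms n M) (g : SmoothRiemannianMetric n M),
      (OneForm.exactForms n M).mkQ α = ξ ∧ IsNegDual X α g) ∧
    ∀ (q : M → ℕ) (e : M → OpenPartialHomeomorph M (EuclideanSpace ℝ (Fin n))),
      (∀ x : M, X x = 0 → IsMorseChart X x (q x) (e x)) →
      ∃ (α : OneForm.closedForms n M) (g : SmoothRiemannianMetric n M),
        (OneForm.exactForms n M).mkQ α = ξ ∧ IsNegDual X α g ∧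
          ∀ x : M, X x = 0 →
            OneForm.IsStandardNear (α : OneForm n M) x (q x) (e x) ∧
              IsEuclideanNear g x (e x) := by
  have main : ∀ (q : M → ℕ) (e : M → OpenPartialHomeomorph M (EuclideanSpace ℝ (Fin n))),
      (∀ x : M, X x = 0 → IsMorseChart X x (q x) (e x)) →
      ∃ (α : OneForm.closedForms n M) (g : SmoothRiemannianMetric n M),
        (OneForm.exactForms n M).mkQ α = ξ ∧ IsNegDual X α g ∧
          ∀ x : M, X x = 0 →
            OneForm.IsStandardNear (α : OneForm n M) x (q x) (e x) ∧
              IsEuclideanNear g x (e x) := by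
    intro q e he
    obtain ⟨α, hα, rfl⟩ := hξ
    obtain ⟨f, hf, hstd⟩ := hα.exists_isStandardNear_zeros he
    obtain ⟨g, hg, hgE⟩ := hf.exists_isNegDual he hstd
    refine ⟨⟨α + OneForm.differential f, hf.1⟩, g, ?_, hg, fun x hx => ⟨hstd x hx, hgE x hx⟩⟩
    rw [Submodule.mkQ_apply, Submodule.mkQ_apply, Submodule.Quotient.eq]
    refine ⟨f, fun x v => ?_⟩
    change (α : OneForm n M) x v + OneForm.differential f x v - (α : OneForm n M) x v = _
    rw [add_sub_cancel_left, OneForm.differential_apply]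
  refine ⟨?_, main⟩
  have hchart : ∀ x : M, ∃ (q : ℕ) (e : OpenPartialHomeomorph M (EuclideanSpace ℝ (Fin n))),
      X x = 0 → IsMorseChart X x q e := fun x => by
    by_cases hx : X x = 0
    · obtain ⟨-, q, e, h⟩ := hX x hx
      exact ⟨q, e, fun _ => h⟩
    · exact ⟨0, chartAt _ x, fun h => absurd h hx⟩
  choose q e he using hchart
  obtain ⟨α, g, h1, h2, -⟩ := main q e he
  exact ⟨α, g, h1, h2⟩
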